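/- Let $n\ge 4$ and let $\mathbb{R}^{n+1}_1$ be Minkowski space with scalar product $xy=-x_0y_0+x_1y_1+\dots+x_ny_n$. Let $M$ be a smooth $n$-dimensional manifold and $Z:M\to\mathbb{R}^{n+1}_1$ a smooth space-like hypersurface (the induced scalar product $g(X,Y)=dZ(X)\,dZ(Y)$ is positive definite). Suppose that $M$ is a canal space-like hypersurface, i.e. there are a smooth submersion $s:M\to\mathbb{R}$, with $J=s(M)$, and smooth functions $z:J\to\mathbb{R}^{n+1}_1$, $R:J\to(0,\infty)$ such that, for every $s_0\in J$, the generator $S(s_0)=Z(\{s=s_0\})$ lies in the cross-section of a space-like hypersphere $\{(x-c)^2=-r^2\}$, $r>0$, with a hyperplane; the normal lines of $M$ at the points of $\{s=s_0\}$ all pass through $z(s_0)$; and $R(s_0)$ is the radius of the space-like hypersphere with center $z(s_0)$ containing $S(s_0)$, i.e. $(Z-z(s_0))^2=-R(s_0)^2$ on $\{s=s_0\}$. Suppose that $M$ is of parabolic type, i.e. the curve of centers is light-like: $z'(s_0)\neq 0$ and $z'(s_0)^2=0$ for all $s_0\in J$. Put $t=z'$, $N=-(Z-z)/R$. Then $(t-R'N)^2>0$,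 and $\xi=(t-R'N)/\sqrt{(t-R'N)^2}$ is a smooth unit tangent vector field of $M$ such that $(M,g,\xi)$ is a Riemannian QC-manifold: the sectional curvature of a 2-plane $E\subset T_pM$ depends only on $p$ and on the angle $\angle(E,\xi)$. Moreover, with $\eta=g(\xi,\cdot)$, there are smooth functions $a,b,k$ on $M$, with $b$ nowhere zero, such that the curvature tensor of $g$ is $\mathcal R=a\pi+b\Phi$, where $$\pi(X,Y,Z,U)=g(Y,Z)g(X,U)-g(X,Z)g(Y,U),$$ $$\Phi(X,Y,Z,U)=g(Y,Z)\eta(X)\eta(U)-g(X,Z)\eta(Y)\eta(U)+g(X,U)\eta(Y)\eta(Z)-g(Y,U)\eta(X)\eta(Z),$$ and $\nabla_x\xi=k\,x$ for all $x\perp\xi$, $k=\xi(a)/(2b)$; and these curvature functions satisfy $$a=-\frac{1}{R^2},\qquad a+k^2=0 .$$ -/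

import Mathlib

open scoped Manifold ContDiff

noncomputable section

namespace CanalQC

/-! ### Minkowski space -/

/-- The underlying vector space of the Minkowski space `ℝ^{n+1}_1`
(the topology and the smooth structure are the usual ones of `ℝ^{n+1}`). -/
abbrev MinkowskiSpace (n : ℕ) : Type := EuclideanSpace ℝ (Fin (n + 1))

/-- The Lorentzian scalar product `x y = -x₀ y₀ + x₁ y₁ + ⋯ + xₙ yₙ`. -/
def minkowski (n : ℕ) : MinkowskiSpace n →L[ℝ] MinkowskiSpace n →L[ℝ] ℝ :=
  -((EuclideanSpace.proj (0 : Fin (n + 1)) : MinkowskiSpace n →L[ℝ] ℝ).smulRight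
      (EuclideanSpace.proj (0 : Fin (n + 1)) : MinkowskiSpace n →L[ℝ] ℝ))
    + ∑ i : Fin n, (EuclideanSpace.proj i.succ : MinkowskiSpace n →L[ℝ] ℝ).smulRight
        (EuclideanSpace.proj i.succ : MinkowskiSpace n →L[ℝ] ℝ)

theorem minkowski_apply (n : ℕ) (x y : MinkowskiSpace n) :
    minkowski n x y = -(x 0 * y 0) + ∑ i : Fin n, x i.succ * y i.succ := by
  simp [minkowski]

theorem minkowski_symm (n : ℕ) (x y : MinkowskiSpace n) :
    minkowski n x y = minkowski n y x := by
  simp [minkowski_apply, mul_comm]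

/-- A vector is light-like if it is a nonzero null vector. -/
def IsLightLike {n : ℕ} (v : MinkowskiSpace n) : Prop := v ≠ 0 ∧ minkowski n v v = 0

/-- The space-like hypersphere `(x - c)² = -r²` of center `c` and radius `r > 0`. -/
def spacelikeHypersphere {n : ℕ} (c : MinkowskiSpace n) (r : ℝ) : Set (MinkowskiSpace n) :=
  {x | minkowski n (x - c) (x - c) = -r ^ 2}

/-- The hyperplane `m x = κ`; every affine hyperplane is of this form with some `m ≠ 0`, because the
scalar product is non-degenerate. -/
def hyperplane {n : ℕ} (m : MinkowskiSpace n) (κ : ℝ) : Set (MinkowskiSpace n) :=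
  {x | minkowski n m x = κ}

/-- `S` is a (possibly proper) part of a sphere of codimension two: it lies in the cross-section
of a space-like hypersphere with a hyperplane. -/
def LiesInSphereOfCodimTwo {n : ℕ} (S : Set (MinkowskiSpace n)) : Prop :=
  ∃ (c : MinkowskiSpace n) (r : ℝ) (m : MinkowskiSpace n) (κ : ℝ),
    0 < r ∧ m ≠ 0 ∧ S ⊆ spacelikeHypersphere c r ∩ hyperplane m κ

/-! ### Riemannian manifolds: Levi-Civita connection and curvature in charts -/

section Coordinates

variable {n : ℕ}

/-- The Gram matrix `g_{ij}` of a field of bilinear forms on (an open part of) `ℝⁿ`. -/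
def gramMatrix
    (G : EuclideanSpace ℝ (Fin n) → EuclideanSpace ℝ (Fin n) → EuclideanSpace ℝ (Fin n) → ℝ)
    (x : EuclideanSpace ℝ (Fin n)) : Matrix (Fin n) (Fin n) ℝ :=
  Matrix.of fun i j => G x (EuclideanSpace.single i 1) (EuclideanSpace.single j 1)

/-- The Christoffel symbols of the first kind,
`Γ(u, v; w) = ½ (∂_u G(v, w) + ∂_v G(u, w) - ∂_w G(u, v))` for constant `u, v, w`. -/
def christoffelFirst
    (G : EuclideanSpace ℝ (Fin n) → EuclideanSpace ℝ (Fin n) → EuclideanSpace ℝ (Fin n) → ℝ)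
    (x u v w : EuclideanSpace ℝ (Fin n)) : ℝ :=
  (1 / 2) * (fderiv ℝ (fun y => G y v w) x u + fderiv ℝ (fun y => G y u w) x v
    - fderiv ℝ (fun y => G y u v) x w)

/-- The Christoffel symbols of the second kind, `Γ(u, v) = ∑ₖ (∑ₗ g^{kl} Γ(u, v; eₗ)) eₖ`. -/
def christoffel
    (G : EuclideanSpace ℝ (Fin n) → EuclideanSpace ℝ (Fin n) → EuclideanSpace ℝ (Fin n) → ℝ)
    (x u v : EuclideanSpace ℝ (Fin n)) : EuclideanSpace ℝ (Fin n) :=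
  ∑ k, (∑ l, (gramMatrix G x)⁻¹ k l * christoffelFirst G x u v (EuclideanSpace.single l 1)) •
    EuclideanSpace.single k (1 : ℝ)

/-- The curvature operator `R(u, v)w = ∇_u ∇_v w - ∇_v ∇_u w` for constant `u, v, w`. -/
def curvatureOperator
    (G : EuclideanSpace ℝ (Fin n) → EuclideanSpace ℝ (Fin n) → EuclideanSpace ℝ (Fin n) → ℝ)
    (x u v w : EuclideanSpace ℝ (Fin n)) : EuclideanSpace ℝ (Fin n) :=
  fderiv ℝ (fun y => christoffel G y v w) x u - fderiv ℝ (fun y => christoffel G y u w) x v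
    + christoffel G x u (christoffel G x v w) - christoffel G x v (christoffel G x u w)

end Coordinates

section Manifold

variable {n : ℕ} {M : Type*} [TopologicalSpace M] [ChartedSpace (EuclideanSpace ℝ (Fin n)) M]
  [IsManifold (𝓡 n) ∞ M]

/-- Smooth Riemannian metrics on the `n`-manifold `M`. -/
abbrev Metric (n : ℕ) (M : Type*) [TopologicalSpace M]
    [ChartedSpace (EuclideanSpace ℝ (Fin n)) M] [IsManifold (𝓡 n) ∞ M] :=
  Bundle.ContMDiffRiemannianMetric (𝓡 n) ∞ (EuclideanSpace ℝ (Fin n))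
    (fun p : M => TangentSpace (𝓡 n) p)

/-- The metric expressed in the preferred chart around `p`. -/
def metricInChart (g : Metric n M) (p : M) (x u v : EuclideanSpace ℝ (Fin n)) : ℝ :=
  g.inner ((extChartAt (𝓡 n) p).symm x)
    (mfderiv 𝓘(ℝ, EuclideanSpace ℝ (Fin n)) (𝓡 n) (extChartAt (𝓡 n) p).symm x u)
    (mfderiv 𝓘(ℝ, EuclideanSpace ℝ (Fin n)) (𝓡 n) (extChartAt (𝓡 n) p).symm x v)

/-- The Riemannian curvature tensor `R(X, Y, Z, U) = g(R(X, Y)Z, U)` at `p`. It is computed in the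
preferred chart around `p`, through which Mathlib identifies `T_pM` with `ℝⁿ`. -/
def curvatureTensor (g : Metric n M) (p : M) (X Y Z U : TangentSpace (𝓡 n) p) : ℝ :=
  g.inner p (curvatureOperator (metricInChart g p) (extChartAt (𝓡 n) p p) X Y Z :
    EuclideanSpace ℝ (Fin n)) U

/-- The Levi-Civita covariant derivative `∇_X V` at `p` of a vector field `V`, computed in the
preferred chart around `p`. -/
def covariantDerivative (g : Metric n M) (V : ∀ p : M, TangentSpace (𝓡 n) p) (p : M)
    (X : TangentSpace (𝓡 n) p) : TangentSpace (𝓡 n) p :=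
  (fderiv ℝ (fun y : EuclideanSpace ℝ (Fin n) =>
      (mfderiv (𝓡 n) 𝓘(ℝ, EuclideanSpace ℝ (Fin n)) (extChartAt (𝓡 n) p)
        ((extChartAt (𝓡 n) p).symm y) (V ((extChartAt (𝓡 n) p).symm y)) :
          EuclideanSpace ℝ (Fin n)))
      (extChartAt (𝓡 n) p p) X
    + christoffel (metricInChart g p) (extChartAt (𝓡 n) p p) X (V p) : EuclideanSpace ℝ (Fin n))

/-- The sectional curvature of the plane spanned by `X, Y`. -/
def sectionalCurvature (g : Metric n M) (p : M) (X Y : TangentSpace (𝓡 n) p) : ℝ :=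
  curvatureTensor g p X Y Y X / (g.inner p X X * g.inner p Y Y - g.inner p X Y ^ 2)

/-- `X, Y` is an orthonormal basis of a plane in `T_pM`. -/
def IsOrthonormalPair (g : Metric n M) (p : M) (X Y : TangentSpace (𝓡 n) p) : Prop :=
  g.inner p X X = 1 ∧ g.inner p Y Y = 1 ∧ g.inner p X Y = 0

/-- The angle `∠(E, ξ) ∈ [0, π/2]` between a unit vector `ξ` and the plane `E` with orthonormal basis
`X, Y`; its cosine is the length of the orthogonal projection of `ξ` onto `E`. -/
def planeAngle (g : Metric n M) (p : M) (ξ X Y : TangentSpace (𝓡 n) p) : ℝ :=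
  Real.arccos (Real.sqrt (g.inner p ξ X ^ 2 + g.inner p ξ Y ^ 2))

/-- `(M, g, ξ)` is a Riemannian QC-manifold: `ξ` is a smooth unit vector field, and the sectional
curvature of a plane `E` in `T_pM` depends only on `p` and on `∠(E, ξ)`. -/
structure IsQCManifold (g : Metric n M) (ξ : ∀ p : M, TangentSpace (𝓡 n) p) : Prop where
  contMDiff : ContMDiff (𝓡 n) (𝓡 n).tangent ∞
    (fun p : M => (⟨p, ξ p⟩ : TangentBundle (𝓡 n) M))
  unit : ∀ p, g.inner p (ξ p) (ξ p) = 1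
  sectional : ∃ K : M → ℝ → ℝ, ∀ (p : M) (X Y : TangentSpace (𝓡 n) p), IsOrthonormalPair g p X Y →
    sectionalCurvature g p X Y = K p (planeAngle g p (ξ p) X Y)

/-- `π(X, Y, Z, U) = g(Y, Z) g(X, U) - g(X, Z) g(Y, U)`. -/
def tensorPi (g : Metric n M) (p : M) (X Y Z U : TangentSpace (𝓡 n) p) : ℝ :=
  g.inner p Y Z * g.inner p X U - g.inner p X Z * g.inner p Y U

/-- `Φ(X, Y, Z, U) = g(Y, Z) η(X) η(U) - g(X, Z) η(Y) η(U) + g(X, U) η(Y) η(Z) - g(Y, U) η(X) η(Z)`,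
where `η = g(ξ, ·)`. -/
def tensorPhi (g : Metric n M) (ξ : ∀ p : M, TangentSpace (𝓡 n) p) (p : M)
    (X Y Z U : TangentSpace (𝓡 n) p) : ℝ :=
  g.inner p Y Z * g.inner p (ξ p) X * g.inner p (ξ p) U
    - g.inner p X Z * g.inner p (ξ p) Y * g.inner p (ξ p) U
    + g.inner p X U * g.inner p (ξ p) Y * g.inner p (ξ p) Z
    - g.inner p Y U * g.inner p (ξ p) X * g.inner p (ξ p) Z

/-- The derivative `X(a)` of a function `a` in the direction of a tangent vector `X` at `p`. -/
def directionalDerivative (a : M → ℝ) (p : M) (X : TangentSpace (𝓡 n) p) : ℝ :=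
  mfderiv (𝓡 n) 𝓘(ℝ, ℝ) a p X

/-- `a, b, k` are the curvature functions of the QC-manifold `(M, g, ξ)`, with `b ≠ 0` everywhere:
the curvature tensor is `a π + b Φ`, and `k = ξ(a) / (2b)` is the function with `∇_x ξ = k x` for all
`x` orthogonal to `ξ`. In particular `a` is the sectional curvature of all planes orthogonal
to `ξ`. -/
structure AreCurvatureFunctions (g : Metric n M) (ξ : ∀ p : M, TangentSpace (𝓡 n) p)
    (a b k : M → ℝ) : Prop where
  contMDiff_a : ContMDiff (𝓡 n) 𝓘(ℝ, ℝ) ∞ a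
  contMDiff_b : ContMDiff (𝓡 n) 𝓘(ℝ, ℝ) ∞ b
  contMDiff_k : ContMDiff (𝓡 n) 𝓘(ℝ, ℝ) ∞ k
  b_ne_zero : ∀ p, b p ≠ 0
  curvature : ∀ (p : M) (X Y Z U : TangentSpace (𝓡 n) p),
    curvatureTensor g p X Y Z U = a p * tensorPi g p X Y Z U + b p * tensorPhi g ξ p X Y Z U
  nabla : ∀ (p : M) (x : TangentSpace (𝓡 n) p), g.inner p (ξ p) x = 0 →
    covariantDerivative g ξ p x = k p • x
  k_eq : ∀ p, k p = directionalDerivative a p (ξ p) / (2 * b p)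

end Manifold

theorem isVonNBounded_of_pos {n : ℕ}
    (B : EuclideanSpace ℝ (Fin n) →L[ℝ] EuclideanSpace ℝ (Fin n) →L[ℝ] ℝ)
    (hB : ∀ v, v ≠ 0 → 0 < B v v) :
    Bornology.IsVonNBounded ℝ {v : EuclideanSpace ℝ (Fin n) | B v v < 1} := by
  have hcont : Continuous fun v => B v v := by fun_prop
  rcases (Metric.sphere (0 : EuclideanSpace ℝ (Fin n)) 1).eq_empty_or_nonempty with he | hne
  · refine (Bornology.isVonNBounded_singleton (0 : EuclideanSpace ℝ (Fin n))).subset ?_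
    intro v _
    by_contra hv
    have hmem : (‖v‖⁻¹ • v) ∈ Metric.sphere (0 : EuclideanSpace ℝ (Fin n)) 1 := by
      simp [norm_smul, norm_ne_zero_iff.mpr hv]
    simp [he] at hmem
  · obtain ⟨u, hu, hmin⟩ := (isCompact_sphere (0 : EuclideanSpace ℝ (Fin n)) 1).exists_isMinOn hne
      hcont.continuousOn
    have hu0 : u ≠ 0 := by
      rintro rfl
      simp at hu
    have hc := hB u hu0
    rw [NormedSpace.isVonNBounded_iff, isBounded_iff_forall_norm_le]
    refine ⟨1 + (B u u)⁻¹, fun v hv => ?_⟩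
    have hv1 : B v v < 1 := hv
    rcases eq_or_ne v 0 with rfl | hv0
    · simp only [norm_zero]
      positivity
    · have hn : 0 < ‖v‖ := norm_pos_iff.mpr hv0
      have hmem : (‖v‖⁻¹ • v) ∈ Metric.sphere (0 : EuclideanSpace ℝ (Fin n)) 1 := by
        simp [norm_smul, hn.ne']
      have h1 : B u u ≤ B (‖v‖⁻¹ • v) (‖v‖⁻¹ • v) := hmin hmem
      simp only [map_smul, smul_apply, smul_eq_mul] at h1
      have h2 : B u u * ‖v‖ ^ 2 ≤ B v v := by
        have h3 := mul_le_mul_of_nonneg_right h1 (sq_nonneg ‖v‖)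
        have h4 : ‖v‖⁻¹ * (‖v‖⁻¹ * B v v) * ‖v‖ ^ 2 = B v v := by field_simp
        linarith
      have h5 : ‖v‖ ^ 2 ≤ (B u u)⁻¹ := by
        rw [le_inv_comm₀ (by positivity) hc, ← one_div, le_div_iff₀ (by positivity)]
        linarith
      nlinarith [sq_nonneg (‖v‖ - 1)]

/-! ### Space-like hypersurfaces -/

section Hypersurface

variable {n : ℕ} {M : Type*} [TopologicalSpace M] [ChartedSpace (EuclideanSpace ℝ (Fin n)) M]

/-- The differential `dF_p(X)` of a map into Minkowski space. -/
def differential (F : M → MinkowskiSpace n) (p : M) :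
    TangentSpace (𝓡 n) p →L[ℝ] MinkowskiSpace n :=
  mfderiv (𝓡 n) 𝓘(ℝ, MinkowskiSpace n) F p

/-- The induced scalar product is positive definite (so `F` is in particular an immersion). -/
def IsSpacelike (F : M → MinkowskiSpace n) : Prop :=
  ∀ (p : M) (X : TangentSpace (𝓡 n) p), X ≠ 0 →
    0 < minkowski n (differential F p X) (differential F p X)

/-- The induced scalar product `(X, Y) ↦ dF(X) dF(Y)` on `T_pM`. -/
def firstFundamentalForm (F : M → MinkowskiSpace n) (p : M) :
    TangentSpace (𝓡 n) p →L[ℝ] TangentSpace (𝓡 n) p →L[ℝ] ℝ :=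
  (ContinuousLinearMap.precomp ℝ (differential F p)).comp ((minkowski n).comp (differential F p))

theorem firstFundamentalForm_apply (F : M → MinkowskiSpace n) (p : M)
    (X Y : TangentSpace (𝓡 n) p) :
    firstFundamentalForm F p X Y = minkowski n (differential F p X) (differential F p Y) := rfl

theorem isVonNBounded_firstFundamentalForm (F : M → MinkowskiSpace n) (hs : IsSpacelike F) (p : M) :
    Bornology.IsVonNBounded ℝ {v : TangentSpace (𝓡 n) p | firstFundamentalForm F p v v < 1} := by
  have h := isVonNBounded_of_pos (n := n) (firstFundamentalForm F p) (hs p)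
  exact h

variable [IsManifold (𝓡 n) ∞ M]

theorem contMDiff_firstFundamentalForm (F : M → MinkowskiSpace n)
    (hF : ContMDiff (𝓡 n) 𝓘(ℝ, MinkowskiSpace n) ∞ F) :
    ContMDiff (𝓡 n) ((𝓡 n).prod 𝓘(ℝ, EuclideanSpace ℝ (Fin n) →L[ℝ] EuclideanSpace ℝ (Fin n) →L[ℝ] ℝ)) ∞
    (fun b ↦ Bundle.TotalSpace.mk' (EuclideanSpace ℝ (Fin n) →L[ℝ] EuclideanSpace ℝ (Fin n) →L[ℝ] ℝ) 
     (E := fun b : M => TangentSpace (𝓡 n) b →L[ℝ] TangentSpace (𝓡 n) b →L[ℝ] ℝ) b (firstFundamentalForm F b)) := by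
    intro x
    rw [Bundle.contMDiffAt_section]
    have hA := (hF.contMDiffAt (x := x)).mfderiv_const (m := ∞) (by simp)
    let A : M → EuclideanSpace ℝ (Fin n) →L[ℝ] MinkowskiSpace n := (inTangentCoordinates (𝓡 n) 𝓘(ℝ, MinkowskiSpace n) id F (mfderiv (𝓡 n) 𝓘(ℝ, MinkowskiSpace n) F) x)
    have hA' : ContMDiffAt (𝓡 n) 𝓘(ℝ, EuclideanSpace ℝ (Fin n) →L[ℝ] MinkowskiSpace n) ∞ A x := hA
    have h2 : ContMDiffAt (𝓡 n) 𝓘(ℝ, EuclideanSpace ℝ (Fin n) →L[ℝ] EuclideanSpace ℝ (Fin n) →L[ℝ] ℝ) ∞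
      (fun b => (minkowski n).bilinearComp (A b) (A b)) x := by
      have hc : ContDiff ℝ ∞ fun L : EuclideanSpace ℝ (Fin n) →L[ℝ] MinkowskiSpace n =>
          (ContinuousLinearMap.precomp ℝ L).comp ((minkowski n).comp L) := by
        have h1 : ContDiff ℝ ∞ fun L : EuclideanSpace ℝ (Fin n) →L[ℝ] MinkowskiSpace n =>
            (ContinuousLinearMap.compL ℝ (EuclideanSpace ℝ (Fin n)) (MinkowskiSpace n) ℝ).flip L := by fun_prop
        exact h1.clm_comp (by fun_prop)
      exact hc.contMDiff.contMDiffAt.comp x hA'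
    refine h2.congr_of_eventuallyEq ?_
    filter_upwards [(trivializationAt (EuclideanSpace ℝ (Fin n)) (TangentSpace (𝓡 n)) x).open_baseSet.mem_nhds (FiberBundle.mem_baseSet_trivializationAt' x)] with b hb
    ext v w
    rw [hom_trivializationAt_apply]
    refine Eq.trans (inCoordinates_apply_eq₂ (F₁ := EuclideanSpace ℝ (Fin n)) (F₂ := EuclideanSpace ℝ (Fin n)) (F₃ := ℝ) (E₁ := fun b : M => TangentSpace (𝓡 n) b) (E₂ := fun b : M => TangentSpace (𝓡 n) b) (E₃ := fun _ : M => ℝ) hb hb (by simp)) ?_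
    have hAb : ∀ u : EuclideanSpace ℝ (Fin n), A b u = differential F b
        ((trivializationAt (EuclideanSpace ℝ (Fin n)) (fun b : M => TangentSpace (𝓡 n) b) x).symm
          b u) := by
      intro u
      have hid : (trivializationAt (MinkowskiSpace n)
          (TangentSpace 𝓘(ℝ, MinkowskiSpace n)) (F x)).continuousLinearMapAt ℝ (F b) =
          ContinuousLinearMap.id ℝ _ := by
        simp
        rfl
      have hs : (trivializationAt (EuclideanSpace ℝ (Fin n)) (TangentSpace (𝓡 n)) x).symmL ℝ b u
          = (trivializationAt (EuclideanSpace ℝ (Fin n)) (TangentSpace (𝓡 n)) x).symm b u :=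
        Bundle.Trivialization.symmL_apply (hb := hb) ..
      simp only [A, inTangentCoordinates, ContinuousLinearMap.inCoordinates]
      erw [hid]
      exact congrArg (differential F b) hs
    simp only [ContinuousLinearMap.bilinearComp_apply, hAb]
    simp [firstFundamentalForm_apply]

/-- The Riemannian metric induced on a space-like hypersurface. -/
def inducedMetric (F : M → MinkowskiSpace n)
    (hF : ContMDiff (𝓡 n) 𝓘(ℝ, MinkowskiSpace n) ∞ F) (hs : IsSpacelike F) : Metric n M where
  inner p := firstFundamentalForm F p
  symm _ _ _ := minkowski_symm n _ _
  pos p v hv := hs p v hv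
  isVonNBounded p := isVonNBounded_firstFundamentalForm F hs p
  contMDiff := contMDiff_firstFundamentalForm F hF

end Hypersurface

/-! ### Canal space-like hypersurfaces -/

section Canal

variable {n : ℕ} {M : Type*} [TopologicalSpace M] [ChartedSpace (EuclideanSpace ℝ (Fin n)) M]

/-- The normal line of the hypersurface at `p`: the line through `F p` orthogonal to the tangent
space `dF(T_pM)`. -/
def normalLine (F : M → MinkowskiSpace n) (p : M) : Set (MinkowskiSpace n) :=
  {q | ∀ X : TangentSpace (𝓡 n) p, minkowski n (q - F p) (differential F p X) = 0}

/-- `F : M → ℝ^{n+1}_1` is a canal space-like hypersurface. The submersion `s : M → ℝ` is the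
parameter of the one-parameter family: the spherical generators are its level sets
`S(s₀) = {s = s₀}`, `s₀ ∈ J`, where the parameter set `J = s(M)` is open (an interval if `M` is
connected). Every spherical generator is a piece of a sphere of codimension two, and the normals
along it pass through the fixed point `z(s₀)`; `R(s₀)` is the radius of the space-like hypersphere
with center `z(s₀)` that contains the generator. -/
structure IsCanalSpacelikeHypersurface (F : M → MinkowskiSpace n) (s : M → ℝ)
    (z : ℝ → MinkowskiSpace n) (R : ℝ → ℝ) : Prop where
  contMDiff : ContMDiff (𝓡 n) 𝓘(ℝ, MinkowskiSpace n) ∞ F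
  spacelike : IsSpacelike F
  contMDiff_param : ContMDiff (𝓡 n) 𝓘(ℝ, ℝ) ∞ s
  submersion : ∀ p : M, ∃ X : TangentSpace (𝓡 n) p, directionalDerivative s p X ≠ 0
  generator : ∀ s₀ ∈ Set.range s, LiesInSphereOfCodimTwo (F '' (s ⁻¹' {s₀}))
  center_mem_normalLine : ∀ p : M, z (s p) ∈ normalLine F p
  radius_pos : ∀ s₀ ∈ Set.range s, 0 < R s₀
  mem_hypersphere : ∀ p : M, F p ∈ spacelikeHypersphere (z (s p)) (R (s p))
  contDiffOn_center : ContDiffOn ℝ ∞ z (Set.range s)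
  contDiffOn_radius : ContDiffOn ℝ ∞ R (Set.range s)

/-- The curve of centers `z(s)`, `s ∈ J`, is light-like. -/
def IsOfParabolicType (s : M → ℝ) (z : ℝ → MinkowskiSpace n) : Prop :=
  ∀ s₀ ∈ Set.range s, IsLightLike (deriv z s₀)

/-- The unit normal `N = -(Z - z) / R`. -/
def unitNormal (F : M → MinkowskiSpace n) (s : M → ℝ) (z : ℝ → MinkowskiSpace n) (R : ℝ → ℝ)
    (p : M) : MinkowskiSpace n :=
  -((R (s p))⁻¹ • (F p - z (s p)))

/-- The vector `t - R' N`, where `t = z'`. -/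
def canalDirection (F : M → MinkowskiSpace n) (s : M → ℝ) (z : ℝ → MinkowskiSpace n) (R : ℝ → ℝ)
    (p : M) : MinkowskiSpace n :=
  deriv z (s p) - deriv R (s p) • unitNormal F s z R p

/-- `ξ` is the vector field `(t - R' N) / √((t - R' N)²)` (as a tangent field of `M`). -/
def IsCanalField (F : M → MinkowskiSpace n) (s : M → ℝ) (z : ℝ → MinkowskiSpace n) (R : ℝ → ℝ)
    (ξ : ∀ p : M, TangentSpace (𝓡 n) p) : Prop :=
  ∀ p : M, 0 < minkowski n (canalDirection F s z R p) (canalDirection F s z R p) ∧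
    differential F p (ξ p) =
      (Real.sqrt (minkowski n (canalDirection F s z R p) (canalDirection F s z R p)))⁻¹ •
        canalDirection F s z R p

end Canal

end CanalQC

end

/-! Everything follows from one identity. Write $\sigma$ for the parameter in a chart, $f$ for the
immersion and $T=z'-R'N$. Differentiating $f=z(\sigma)-R(\sigma)N$ gives $dN=R^{-1}(d\sigma\otimes
T-df)$ (`fderiv_normal`). Since $N^2=-1$, $dN$ is orthogonal to $N$, and $d\sigma\ne0$ then forces
$T\perp N$. So $T$ is tangent, $z'N=-R'$, and $z'^2=0$ gives $T^2=R'^2$. Here $R'\neq0$: otherwise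
$z'=T$ would be a nonzero null vector in a positive definite tangent space. Hence $\xi=T/|R'|$ is a
unit field.

The second fundamental form is symmetric, so $d\sigma\otimes T^\flat$ is too, which makes
$d\sigma=\xi(\sigma)\,\eta$ (`fderiv_param`). Therefore $dN\cdot
df=R^{-1}(|R'|\,\xi(\sigma)\,\eta\otimes\eta-g)$. The Gauss equation for a time-like normal
(`gauss_equation`) turns this into $\mathcal R=a\pi+b\Phi$ with $a=-1/R^2$ and
$b=|R'|\,\xi(\sigma)/R^2$.

If $x\perp\xi$, then $d\sigma(x)=0$, so in $T/|R'|$ only $N$ varies along $x$, and $\nabla_x\xi=kx$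
with $k=R'/(|R'|R)$. Thus $k^2=1/R^2=-a$. On a plane $E$ the curvature is $a+b\cos^2\angle(E,\xi)$.

The connection and the curvature are given by Christoffel symbols in charts. `bilin_christoffel`
identifies them with tangential parts of ambient derivatives, so the argument runs in an open set of
$\mathbb R^n$ (`IsLocalCanal`) and is then transported to $M$. -/

noncomputable section

namespace CanalQC

open Filter Topology

/-! ### Smooth dependence of the inverse matrix -/

section MatrixSmoothness

variable {X : Type*} [NormedAddCommGroup X] [NormedSpace ℝ X] {n : ℕ} {m : WithTop ℕ∞}

theorem contDiffAt_det {A : X → Matrix (Fin n) (Fin n) ℝ} {x : X}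
    (hA : ∀ i j, ContDiffAt ℝ m (fun y => A y i j) x) :
    ContDiffAt ℝ m (fun y => (A y).det) x := by
  simp only [Matrix.det_apply']
  exact ContDiffAt.sum fun σ _ => contDiffAt_const.mul (contDiffAt_prod fun i _ => hA _ _)

/-- Cramer's rule: an entry of the adjugate is the determinant of $A$ with one row replaced by a
constant unit vector. -/
theorem contDiffAt_inv_apply {A : X → Matrix (Fin n) (Fin n) ℝ} {x : X}
    (hA : ∀ i j, ContDiffAt ℝ m (fun y => A y i j) x) (hx : (A x).det ≠ 0) (i j : Fin n) :
    ContDiffAt ℝ m (fun y => (A y)⁻¹ i j) x := by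
  simp only [Matrix.inv_def, Ring.inverse_eq_inv', Matrix.smul_apply, smul_eq_mul,
    Matrix.adjugate_apply]
  refine ((contDiffAt_det hA).inv hx).mul (contDiffAt_det fun k l => ?_)
  by_cases hk : k = j
  · subst hk
    simpa using contDiffAt_const
  · simpa [Matrix.updateRow_ne hk] using hA k l

end MatrixSmoothness

/-! ### Linear algebra of an indefinite form that is positive on the image of $L$ -/

section Gram

variable {n : ℕ} {V : Type*} [NormedAddCommGroup V] [NormedSpace ℝ V]
  {B : V →L[ℝ] V →L[ℝ] ℝ}
  {G : EuclideanSpace ℝ (Fin n) → EuclideanSpace ℝ (Fin n) → EuclideanSpace ℝ (Fin n) → ℝ}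
  {x : EuclideanSpace ℝ (Fin n)} {L : EuclideanSpace ℝ (Fin n) →L[ℝ] V}

theorem euclidean_sum_single (q : EuclideanSpace ℝ (Fin n)) :
    ∑ i, q i • EuclideanSpace.single i (1 : ℝ) = q := by
  simpa using (EuclideanSpace.basisFun (Fin n) ℝ).sum_repr q

theorem gramMatrix_mulVec (hG : ∀ u v, G x u v = B (L u) (L v))
    (q : EuclideanSpace ℝ (Fin n)) (i : Fin n) :
    (gramMatrix G x).mulVec (fun j => q j) i = B (L (EuclideanSpace.single i 1)) (L q) := by
  conv_rhs => rw [← euclidean_sum_single q]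
  simp [Matrix.mulVec, dotProduct, gramMatrix, hG, mul_comm]

/-- A kernel vector $q$ would make $Lq$ orthogonal to every $Le_i$, hence to itself, against
positivity. -/
theorem gramMatrix_det_ne_zero (hG : ∀ u v, G x u v = B (L u) (L v))
    (hL : ∀ u, u ≠ 0 → 0 < B (L u) (L u)) : (gramMatrix G x).det ≠ 0 := by
  intro h
  obtain ⟨v, hv, hv0⟩ := Matrix.exists_mulVec_eq_zero_iff.mpr h
  set q : EuclideanSpace ℝ (Fin n) := WithLp.toLp 2 v
  have hq : q ≠ 0 := by
    intro h0
    apply hv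
    funext i
    exact congrArg (fun w : EuclideanSpace ℝ (Fin n) => w i) h0
  have hi : ∀ i, B (L (EuclideanSpace.single i 1)) (L q) = 0 := by
    intro i
    rw [← gramMatrix_mulVec hG]
    exact congrFun hv0 i
  have : B (L q) (L q) = 0 := by
    have h1 : L q = ∑ i, q i • L (EuclideanSpace.single i 1) := by
      conv_lhs => rw [← euclidean_sum_single q]
      simp
    have key : ∀ c, (∀ i, B (L (EuclideanSpace.single i 1)) c = 0) → B (L q) c = 0 := by
      intro c hc
      rw [h1]
      simp [hc]
    exact key _ hi
  exact (hL q hq).ne' this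

/-- The inverse Gram matrix raises an index: the sum is the vector representing the functional
$e_j\mapsto\psi_j$. It has exactly the shape used in `christoffel`. -/
theorem gramMatrix_inv_spec (hB : ∀ v w, B v w = B w v) (hG : ∀ u v, G x u v = B (L u) (L v))
    (hL : ∀ u, u ≠ 0 → 0 < B (L u) (L u)) (ψ : Fin n → ℝ) (j : Fin n) :
    B (L (∑ k, (∑ l, (gramMatrix G x)⁻¹ k l * ψ l) • EuclideanSpace.single k (1 : ℝ)))
      (L (EuclideanSpace.single j 1)) = ψ j := by
  have hdet := (gramMatrix_det_ne_zero hG hL).isUnit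
  have h1 : (∑ k, (∑ l, (gramMatrix G x)⁻¹ k l * ψ l) • EuclideanSpace.single k (1 : ℝ))
      = WithLp.toLp 2 ((gramMatrix G x)⁻¹.mulVec ψ) := by
    conv_rhs => rw [← euclidean_sum_single (WithLp.toLp 2 ((gramMatrix G x)⁻¹.mulVec ψ))]
    rfl
  rw [hB, h1, ← gramMatrix_mulVec hG]
  simp [Matrix.mul_nonsing_inv _ hdet]

theorem bilin_ext_single {c d : V} (h : ∀ j : Fin n, B c (L (EuclideanSpace.single j 1)) =
    B d (L (EuclideanSpace.single j 1))) (q : EuclideanSpace ℝ (Fin n)) :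
    B c (L q) = B d (L q) := by
  rw [← euclidean_sum_single q]
  simp [h]

/-- Although $B$ may be indefinite on $V$, tangent vectors can be compared by testing against
tangent vectors only. -/
theorem eq_of_bilin_eq (hL : ∀ u, u ≠ 0 → 0 < B (L u) (L u)) {u v : EuclideanSpace ℝ (Fin n)}
    (h : ∀ q, B (L u) (L q) = B (L v) (L q)) : u = v := by
  by_contra hne
  have h1 := hL (u - v) (sub_ne_zero.mpr hne)
  have h2 := h (u - v)
  simp only [map_sub, sub_apply] at h1 h2
  linarith

theorem injective_of_pos (hL : ∀ u, u ≠ 0 → 0 < B (L u) (L u)) {u v : EuclideanSpace ℝ (Fin n)}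
    (h : L u = L v) : u = v :=
  eq_of_bilin_eq hL fun q => by rw [h]

/-- Decomposition of a vector into its tangential part and its part along the unit normal `N`. -/
theorem exists_tangent_decomposition [FiniteDimensional ℝ V] (hV : Module.finrank ℝ V = n + 1)
    (hL : ∀ u, u ≠ 0 → 0 < B (L u) (L u)) {N : V} (hN : B N N = -1) (hB : ∀ v w, B v w = B w v)
    (hp : ∀ u, B N (L u) = 0) (c : V) : ∃ u, c = L u - B c N • N := by
  -- $T(u,t)=Lu+tN$ acts between spaces of dimension $n+1$. Pairing with $N$ recovers $-t$, so $T$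
  -- is injective and hence onto.
  let T : (EuclideanSpace ℝ (Fin n) × ℝ) →ₗ[ℝ] V :=
    (L : EuclideanSpace ℝ (Fin n) →ₗ[ℝ] V).coprod (LinearMap.toSpanSingleton ℝ V N)
  have hT : ∀ a, T a = L a.1 + a.2 • N := fun a => by simp [T]
  have hTN : ∀ a, B (T a) N = -a.2 := fun a => by
    simp [hT, hB (L a.1) N, hp, hN]
  have hinj : Function.Injective T := by
    rw [injective_iff_map_eq_zero]
    intro a ha
    have h2 : a.2 = 0 := by simpa [ha] using hTN a
    have h1 : L a.1 = L 0 := by simpa [hT, h2] using ha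
    exact Prod.ext (injective_of_pos hL h1) h2
  have hsurj : Function.Surjective T :=
    (LinearMap.injective_iff_surjective_of_finrank_eq_finrank (by simp [hV])).mp hinj
  obtain ⟨a, rfl⟩ := hsurj c
  exact ⟨a.1, by rw [hTN, hT]; simp⟩

end Gram

/-! ### Gauss formula, Gauss equation and covariant derivative in a coordinate domain -/

section LocalGeometry

variable {n : ℕ} {V : Type*} [NormedAddCommGroup V] [NormedSpace ℝ V]
  {B : V →L[ℝ] V →L[ℝ] ℝ}
  {G : EuclideanSpace ℝ (Fin n) → EuclideanSpace ℝ (Fin n) → EuclideanSpace ℝ (Fin n) → ℝ}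
  {U : Set (EuclideanSpace ℝ (Fin n))} {f : EuclideanSpace ℝ (Fin n) → V}
  {x : EuclideanSpace ℝ (Fin n)}

theorem contDiffOn_fderiv_top {X Y : Type*} [NormedAddCommGroup X] [NormedSpace ℝ X]
    [NormedAddCommGroup Y] [NormedSpace ℝ Y] {h : X → Y} {W : Set X} (hW : IsOpen W)
    (hh : ContDiffOn ℝ ∞ h W) : ContDiffOn ℝ ∞ (fderiv ℝ h) W :=
  hh.fderiv_of_isOpen hW (by simp)

theorem contDiffOn_fderiv_apply_const {X Y : Type*} [NormedAddCommGroup X] [NormedSpace ℝ X]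
    [NormedAddCommGroup Y] [NormedSpace ℝ Y] {h : X → Y} {W : Set X} (hW : IsOpen W)
    (hh : ContDiffOn ℝ ∞ h W) (v : X) : ContDiffOn ℝ ∞ (fun y => fderiv ℝ h y v) W :=
  (contDiffOn_fderiv_top hW hh).clm_apply contDiffOn_const

theorem differentiableAt_of_contDiffOn {X Y : Type*} [NormedAddCommGroup X] [NormedSpace ℝ X]
    [NormedAddCommGroup Y] [NormedSpace ℝ Y] {h : X → Y} {W : Set X} (hW : IsOpen W)
    (hh : ContDiffOn ℝ ∞ h W) {y : X} (hy : y ∈ W) : DifferentiableAt ℝ h y :=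
  (hh.differentiableOn (by simp)).differentiableAt (hW.mem_nhds hy)

theorem fderiv_fderiv_apply {X Y : Type*} [NormedAddCommGroup X] [NormedSpace ℝ X]
    [NormedAddCommGroup Y] [NormedSpace ℝ Y] {h : X → Y} {W : Set X} (hW : IsOpen W)
    (hh : ContDiffOn ℝ ∞ h W) {y : X} (hy : y ∈ W) (u v : X) :
    fderiv ℝ (fun y => fderiv ℝ h y v) y u = fderiv ℝ (fderiv ℝ h) y u v := by
  rw [fderiv_clm_apply (differentiableAt_of_contDiffOn hW (contDiffOn_fderiv_top hW hh) hy)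
    (differentiableAt_const v)]
  simp

theorem fderiv_fderiv_symm {X Y : Type*} [NormedAddCommGroup X] [NormedSpace ℝ X]
    [NormedAddCommGroup Y] [NormedSpace ℝ Y] {h : X → Y} {W : Set X} (hW : IsOpen W)
    (hh : ContDiffOn ℝ ∞ h W) {y : X} (hy : y ∈ W) (u v : X) :
    fderiv ℝ (fderiv ℝ h) y u v = fderiv ℝ (fderiv ℝ h) y v u :=
  (hh.contDiffAt (hW.mem_nhds hy)).isSymmSndFDerivAt
    (by simpa using WithTop.coe_le_coe.mpr (le_top : (2 : ℕ∞) ≤ ⊤)) u v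

theorem fderiv_bilin {X : Type*} [NormedAddCommGroup X] [NormedSpace ℝ X] {c d : X → V} {y : X}
    (hc : DifferentiableAt ℝ c y) (hd : DifferentiableAt ℝ d y) (u : X) :
    fderiv ℝ (fun y => B (c y) (d y)) y u = B (fderiv ℝ c y u) (d y) + B (c y) (fderiv ℝ d y u) := by
  have h : HasFDerivAt (fun y => B (c y) (d y))
      (B.precompR X (c y) (fderiv ℝ d y) + B.precompL X (fderiv ℝ c y) (d y)) y :=
    B.hasFDerivAt_of_bilinear hc.hasFDerivAt hd.hasFDerivAt
  rw [h.fderiv]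
  simp [add_comm]

theorem differentiableAt_bilin {X : Type*} [NormedAddCommGroup X] [NormedSpace ℝ X] {c d : X → V}
    {y : X} (hc : DifferentiableAt ℝ c y) (hd : DifferentiableAt ℝ d y) :
    DifferentiableAt ℝ (fun y => B (c y) (d y)) y :=
  (B.hasFDerivAt_of_bilinear hc.hasFDerivAt hd.hasFDerivAt).differentiableAt

/-- The Christoffel vector solves the Gauss formula: `df(Γ(u, v))` is the tangential part of the
second derivative of `f`. -/
theorem bilin_christoffel (hB : ∀ v w, B v w = B w v) (hU : IsOpen U) (hf : ContDiffOn ℝ ∞ f U)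
    (hpos : ∀ y ∈ U, ∀ u, u ≠ 0 → 0 < B (fderiv ℝ f y u) (fderiv ℝ f y u))
    (hG : ∀ y ∈ U, ∀ u v, G y u v = B (fderiv ℝ f y u) (fderiv ℝ f y v)) (hx : x ∈ U)
    (u v q : EuclideanSpace ℝ (Fin n)) :
    B (fderiv ℝ f x (christoffel G x u v)) (fderiv ℝ f x q) =
      B (fderiv ℝ (fderiv ℝ f) x u v) (fderiv ℝ f x q) := by
  have hd : ∀ v w u, fderiv ℝ (fun y => G y v w) x u =
      B (fderiv ℝ (fderiv ℝ f) x u v) (fderiv ℝ f x w) +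
        B (fderiv ℝ f x v) (fderiv ℝ (fderiv ℝ f) x u w) := by
    intro v w u
    have h1 : (fun y => G y v w) =ᶠ[𝓝 x] fun y => B (fderiv ℝ f y v) (fderiv ℝ f y w) := by
      filter_upwards [hU.mem_nhds hx] with y hy using hG y hy v w
    have h2 := fun v => differentiableAt_of_contDiffOn hU (contDiffOn_fderiv_apply_const hU hf v) hx
    rw [h1.fderiv_eq, fderiv_bilin (h2 v) (h2 w), fderiv_fderiv_apply hU hf hx,
      fderiv_fderiv_apply hU hf hx]
  have hs := fderiv_fderiv_symm hU hf hx
  refine bilin_ext_single (fun j => ?_) q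
  -- The three metric derivatives give six terms. By symmetry of $D^2f$ four cancel, and the other
  -- two coincide and absorb the factor $1/2$.
  rw [christoffel, gramMatrix_inv_spec hB (hG x hx) (hpos x hx), christoffelFirst, hd, hd, hd,
    hs (EuclideanSpace.single j 1) u, hs (EuclideanSpace.single j 1) v, hs v u,
    hB (fderiv ℝ f x v), hB (fderiv ℝ f x u)]
  ring

/-- A vector field whose image under `df` has the same tangential part as a smooth field is
smooth. -/
theorem contDiffOn_of_bilin_eq (hB : ∀ v w, B v w = B w v) (hU : IsOpen U)
    (hf : ContDiffOn ℝ ∞ f U)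
    (hpos : ∀ y ∈ U, ∀ u, u ≠ 0 → 0 < B (fderiv ℝ f y u) (fderiv ℝ f y u))
    {v : EuclideanSpace ℝ (Fin n) → EuclideanSpace ℝ (Fin n)}
    {c : EuclideanSpace ℝ (Fin n) → V} (hc : ContDiffOn ℝ ∞ c U)
    (hv : ∀ y ∈ U, ∀ q, B (fderiv ℝ f y (v y)) (fderiv ℝ f y q) = B (c y) (fderiv ℝ f y q)) :
    ContDiffOn ℝ ∞ v U := by
  let G₀ : EuclideanSpace ℝ (Fin n) → EuclideanSpace ℝ (Fin n) → EuclideanSpace ℝ (Fin n) → ℝ :=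
    fun y u v => B (fderiv ℝ f y u) (fderiv ℝ f y v)
  -- The pairings with the coordinate frame determine $v$, so it is an explicit expression in smooth
  -- functions.
  have hv' : ∀ y ∈ U, v y = ∑ k, (∑ l, (gramMatrix G₀ y)⁻¹ k l *
      B (c y) (fderiv ℝ f y (EuclideanSpace.single l 1))) • EuclideanSpace.single k (1 : ℝ) := by
    intro y hy
    refine eq_of_bilin_eq (hpos y hy) (bilin_ext_single fun j => ?_)
    rw [gramMatrix_inv_spec hB (G := G₀) (fun _ _ => rfl) (hpos y hy)
      (fun l => B (c y) (fderiv ℝ f y (EuclideanSpace.single l 1))), hv y hy]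
  refine ContDiffOn.congr (fun y hy => ContDiffAt.contDiffWithinAt ?_) hv'
  have hdf : ∀ w, ContDiffAt ℝ ∞ (fun y => fderiv ℝ f y w) y := fun w =>
    (contDiffOn_fderiv_apply_const hU hf w).contDiffAt (hU.mem_nhds hy)
  have hbil : ∀ {c d : EuclideanSpace ℝ (Fin n) → V}, ContDiffAt ℝ ∞ c y → ContDiffAt ℝ ∞ d y →
      ContDiffAt ℝ ∞ (fun y => B (c y) (d y)) y := fun hc hd =>
    (B.contDiff.contDiffAt.comp y hc).clm_apply hd
  refine ContDiffAt.sum fun k _ => ContDiffAt.fun_smul (ContDiffAt.sum fun l _ => ?_) contDiffAt_const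
  refine ContDiffAt.mul ?_ (hbil (hc.contDiffAt (hU.mem_nhds hy)) (hdf _))
  exact contDiffAt_inv_apply (fun i j => hbil (hdf _) (hdf _))
    (gramMatrix_det_ne_zero (G := G₀) (fun _ _ => rfl) (hpos y hy)) k l

/-- The Gauss equation of a space-like hypersurface with unit normal `N`. -/
theorem gauss_equation [FiniteDimensional ℝ V] (hV : Module.finrank ℝ V = n + 1)
    (hB : ∀ v w, B v w = B w v) (hU : IsOpen U)
    (hf : ContDiffOn ℝ ∞ f U)
    (hpos : ∀ y ∈ U, ∀ u, u ≠ 0 → 0 < B (fderiv ℝ f y u) (fderiv ℝ f y u))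
    (hG : ∀ y ∈ U, ∀ u v, G y u v = B (fderiv ℝ f y u) (fderiv ℝ f y v))
    {N : EuclideanSpace ℝ (Fin n) → V} (hN : ContDiffOn ℝ ∞ N U)
    (hNN : ∀ y ∈ U, B (N y) (N y) = -1) (hNf : ∀ y ∈ U, ∀ u, B (N y) (fderiv ℝ f y u) = 0)
    (hx : x ∈ U) (u v w q : EuclideanSpace ℝ (Fin n)) :
    B (fderiv ℝ f x (curvatureOperator G x u v w)) (fderiv ℝ f x q) =
      -(B (fderiv ℝ N x v) (fderiv ℝ f x w) * B (fderiv ℝ N x u) (fderiv ℝ f x q)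
        - B (fderiv ℝ N x u) (fderiv ℝ f x w) * B (fderiv ℝ N x v) (fderiv ℝ f x q)) := by
  have hxU := hU.mem_nhds hx
  -- The Gauss formula as an identity of vectors. The normal component enters with a plus sign
  -- because $N^2=-1$.
  have hΓ : ∀ v w, ∀ y ∈ U, fderiv ℝ f y (christoffel G y v w) =
      fderiv ℝ (fun y => fderiv ℝ f y w) y v +
        B (fderiv ℝ (fun y => fderiv ℝ f y w) y v) (N y) • N y := by
    intro v w y hy
    obtain ⟨a, ha⟩ := exists_tangent_decomposition hV (hpos y hy) (hNN y hy) hB (hNf y hy)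
      (fderiv ℝ (fun y => fderiv ℝ f y w) y v)
    have h1 : christoffel G y v w = a := by
      refine eq_of_bilin_eq (hpos y hy) fun q => ?_
      rw [bilin_christoffel hB hU hf hpos hG hy, ← fderiv_fderiv_apply hU hf hy, ha]
      simp [hNf y hy]
    rw [h1, ← sub_eq_iff_eq_add]
    exact ha.symm
  have hΓd : ∀ v w, DifferentiableAt ℝ (fun y => christoffel G y v w) x := by
    intro v w
    refine differentiableAt_of_contDiffOn hU (contDiffOn_of_bilin_eq hB hU hf hpos
      (contDiffOn_fderiv_apply_const hU (contDiffOn_fderiv_apply_const hU hf w) v)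
      fun y hy q => ?_) hx
    rw [bilin_christoffel hB hU hf hpos hG hy, fderiv_fderiv_apply hU hf hy]
  have hND := differentiableAt_of_contDiffOn hU hN hx
  have hfD := differentiableAt_of_contDiffOn hU (contDiffOn_fderiv_top hU hf) hx
  have hD2 : ∀ v w, DifferentiableAt ℝ (fun y => fderiv ℝ (fun y => fderiv ℝ f y w) y v) x :=
    fun v w => differentiableAt_of_contDiffOn hU
      (contDiffOn_fderiv_apply_const hU (contDiffOn_fderiv_apply_const hU hf w) v) hx
  -- Differentiate $N\cdot df(w)=0$.
  have hh : ∀ v w, B (fderiv ℝ (fun y => fderiv ℝ f y w) x v) (N x) =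
      -B (fderiv ℝ N x v) (fderiv ℝ f x w) := by
    intro v w
    have h0 : (fun y => B (N y) (fderiv ℝ f y w)) =ᶠ[𝓝 x] fun _ => (0 : ℝ) := by
      filter_upwards [hxU] with y hy using hNf y hy w
    have h1 := congrArg (fun T : EuclideanSpace ℝ (Fin n) →L[ℝ] ℝ => T v) h0.fderiv_eq
    rw [fderiv_bilin hND (hfD.clm_apply (differentiableAt_const w))] at h1
    rw [hB]
    simp at h1
    linarith
  -- Differentiate the Gauss formula along $u$ and pair with a tangent vector: the multiple of $N$
  -- drops out, leaving the third derivative of $f$ and the term with $dN(u)$.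
  have hder : ∀ u v w, B (fderiv ℝ f x (fderiv ℝ (fun y => christoffel G y v w) x u +
      christoffel G x u (christoffel G x v w))) (fderiv ℝ f x q) =
      B (fderiv ℝ (fun y => fderiv ℝ (fun y => fderiv ℝ f y w) y v) x u) (fderiv ℝ f x q)
        - B (fderiv ℝ N x v) (fderiv ℝ f x w) * B (fderiv ℝ N x u) (fderiv ℝ f x q) := by
    intro u v w
    have h0 : (fun y => fderiv ℝ f y (christoffel G y v w)) =ᶠ[𝓝 x] fun y =>
        fderiv ℝ (fun y => fderiv ℝ f y w) y v +
        B (fderiv ℝ (fun y => fderiv ℝ f y w) y v) (N y) • N y := by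
      filter_upwards [hxU] with y hy using hΓ v w y hy
    have h1 := congrArg (fun T : EuclideanSpace ℝ (Fin n) →L[ℝ] V => B (T u) (fderiv ℝ f x q)) h0.fderiv_eq
    have hs : DifferentiableAt ℝ (fun y => B (fderiv ℝ (fun y => fderiv ℝ f y w) y v) (N y)) x :=
      differentiableAt_bilin (hD2 v w) hND
    rw [fderiv_clm_apply hfD (hΓd v w), fderiv_fun_add (hD2 v w) (hs.fun_smul hND),
      fderiv_fun_smul hs hND] at h1
    simp only [add_apply, ContinuousLinearMap.comp_apply, ContinuousLinearMap.flip_apply,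
      smul_apply, ContinuousLinearMap.smulRight_apply, map_add, map_smul, smul_eq_mul, hNf x hx,
      hh] at h1
    rw [map_add, map_add, add_apply, bilin_christoffel hB hU hf hpos hG hx]
    linarith
  -- Third derivatives of $f$ commute, so they cancel when $u$ and $v$ are antisymmetrized.
  have hsym : fderiv ℝ (fun y => fderiv ℝ (fun y => fderiv ℝ f y w) y v) x u =
      fderiv ℝ (fun y => fderiv ℝ (fun y => fderiv ℝ f y w) y u) x v := by
    have hw := contDiffOn_fderiv_apply_const hU hf w
    rw [fderiv_fderiv_apply hU hw hx, fderiv_fderiv_apply hU hw hx, fderiv_fderiv_symm hU hw hx]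
  have e : curvatureOperator G x u v w = (fderiv ℝ (fun y => christoffel G y v w) x u +
      christoffel G x u (christoffel G x v w)) - (fderiv ℝ (fun y => christoffel G y u w) x v +
      christoffel G x v (christoffel G x u w)) := by
    rw [curvatureOperator]; abel
  rw [e, map_sub, map_sub, sub_apply, hder, hder, hsym]
  ring

end LocalGeometry

theorem fderiv_comp_real {X Y : Type*} [NormedAddCommGroup X] [NormedSpace ℝ X]
    [NormedAddCommGroup Y] [NormedSpace ℝ Y] {c : ℝ → Y} {σ : X → ℝ} {x : X}
    (hc : DifferentiableAt ℝ c (σ x)) (hσ : DifferentiableAt ℝ σ x) (u : X) :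
    fderiv ℝ (fun y => c (σ y)) x u = fderiv ℝ σ x u • deriv c (σ x) := by
  have h := fderiv_comp x hc hσ
  rw [Function.comp_def] at h
  rw [h, ContinuousLinearMap.comp_apply, fderiv_eq_smul_deriv]

/-- Weingarten-type formula: the Levi-Civita derivative of a tangent field is the tangential part
of its ambient derivative. -/
theorem bilin_covariantDerivative {n : ℕ} {V : Type*} [NormedAddCommGroup V] [NormedSpace ℝ V]
    {B : V →L[ℝ] V →L[ℝ] ℝ}
    {G : EuclideanSpace ℝ (Fin n) → EuclideanSpace ℝ (Fin n) → EuclideanSpace ℝ (Fin n) → ℝ}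
    {U : Set (EuclideanSpace ℝ (Fin n))} {f : EuclideanSpace ℝ (Fin n) → V}
    {x : EuclideanSpace ℝ (Fin n)} (hB : ∀ v w, B v w = B w v) (hU : IsOpen U)
    (hf : ContDiffOn ℝ ∞ f U)
    (hpos : ∀ y ∈ U, ∀ u, u ≠ 0 → 0 < B (fderiv ℝ f y u) (fderiv ℝ f y u))
    (hG : ∀ y ∈ U, ∀ u v, G y u v = B (fderiv ℝ f y u) (fderiv ℝ f y v)) (hx : x ∈ U)
    {v : EuclideanSpace ℝ (Fin n) → EuclideanSpace ℝ (Fin n)}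
    {c : EuclideanSpace ℝ (Fin n) → V} (hv : DifferentiableAt ℝ v x)
    (hvc : ∀ y ∈ U, fderiv ℝ f y (v y) = c y) (u q : EuclideanSpace ℝ (Fin n)) :
    B (fderiv ℝ f x (fderiv ℝ v x u + christoffel G x u (v x))) (fderiv ℝ f x q) =
      B (fderiv ℝ c x u) (fderiv ℝ f x q) := by
  have h0 : (fun y => fderiv ℝ f y (v y)) =ᶠ[𝓝 x] c := by
    filter_upwards [hU.mem_nhds hx] with y hy using hvc y hy
  rw [← h0.fderiv_eq, fderiv_clm_apply
    (differentiableAt_of_contDiffOn hU (contDiffOn_fderiv_top hU hf) hx) hv]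
  simp only [add_apply, ContinuousLinearMap.comp_apply, ContinuousLinearMap.flip_apply, map_add]
  rw [bilin_christoffel hB hU hf hpos hG hx]

/-! ### Local theory of parabolic canal hypersurfaces -/

/-- A canal space-like hypersurface of parabolic type, parametrized by an open set of `ℝⁿ`. -/
structure IsLocalCanal {n : ℕ} (U : Set (EuclideanSpace ℝ (Fin n))) (J : Set ℝ)
    (f : EuclideanSpace ℝ (Fin n) → MinkowskiSpace n) (σ : EuclideanSpace ℝ (Fin n) → ℝ)
    (z : ℝ → MinkowskiSpace n) (R : ℝ → ℝ) : Prop where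
  isOpen : IsOpen U
  isOpen_param : IsOpen J
  contDiffOn : ContDiffOn ℝ ∞ f U
  contDiffOn_param : ContDiffOn ℝ ∞ σ U
  mapsTo : Set.MapsTo σ U J
  contDiffOn_center : ContDiffOn ℝ ∞ z J
  contDiffOn_radius : ContDiffOn ℝ ∞ R J
  pos : ∀ y ∈ U, ∀ u, u ≠ 0 → 0 < minkowski n (fderiv ℝ f y u) (fderiv ℝ f y u)
  center_perp : ∀ y ∈ U, ∀ u, minkowski n (z (σ y) - f y) (fderiv ℝ f y u) = 0
  radius_pos : ∀ r ∈ J, 0 < R r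
  hypersphere : ∀ y ∈ U, minkowski n (f y - z (σ y)) (f y - z (σ y)) = -R (σ y) ^ 2
  submersion : ∀ y ∈ U, ∃ u, fderiv ℝ σ y u ≠ 0
  center_lightLike : ∀ r ∈ J, IsLightLike (deriv z r)

namespace IsLocalCanal

variable {n : ℕ} {U : Set (EuclideanSpace ℝ (Fin n))} {J : Set ℝ}
  {f : EuclideanSpace ℝ (Fin n) → MinkowskiSpace n} {σ : EuclideanSpace ℝ (Fin n) → ℝ}
  {z : ℝ → MinkowskiSpace n} {R : ℝ → ℝ} {x : EuclideanSpace ℝ (Fin n)}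

theorem contDiffOn_comp (h : IsLocalCanal U J f σ z R) {Y : Type*} [NormedAddCommGroup Y]
    [NormedSpace ℝ Y] {c : ℝ → Y} (hc : ContDiffOn ℝ ∞ c J) :
    ContDiffOn ℝ ∞ (fun y => c (σ y)) U :=
  hc.comp h.contDiffOn_param h.mapsTo

theorem contDiffOn_deriv_center (h : IsLocalCanal U J f σ z R) : ContDiffOn ℝ ∞ (deriv z) J :=
  h.contDiffOn_center.deriv_of_isOpen h.isOpen_param (by simp)

theorem contDiffOn_deriv_radius (h : IsLocalCanal U J f σ z R) : ContDiffOn ℝ ∞ (deriv R) J :=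
  h.contDiffOn_radius.deriv_of_isOpen h.isOpen_param (by simp)

theorem radius_ne_zero (h : IsLocalCanal U J f σ z R) (hx : x ∈ U) : R (σ x) ≠ 0 :=
  (h.radius_pos _ (h.mapsTo hx)).ne'

theorem contDiffOn_normal (h : IsLocalCanal U J f σ z R) :
    ContDiffOn ℝ ∞ (unitNormal f σ z R) U :=
  (((h.contDiffOn_comp h.contDiffOn_radius).inv fun _ hy => h.radius_ne_zero hy).smul
    (h.contDiffOn.sub (h.contDiffOn_comp h.contDiffOn_center))).neg

theorem contDiffOn_direction (h : IsLocalCanal U J f σ z R) :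
    ContDiffOn ℝ ∞ (canalDirection f σ z R) U :=
  (h.contDiffOn_comp h.contDiffOn_deriv_center).sub
    ((h.contDiffOn_comp h.contDiffOn_deriv_radius).smul h.contDiffOn_normal)

theorem normal_normal (h : IsLocalCanal U J f σ z R) (hx : x ∈ U) :
    minkowski n (unitNormal f σ z R x) (unitNormal f σ z R x) = -1 := by
  have hR := h.radius_ne_zero hx
  simp only [unitNormal, map_neg, map_smul, neg_apply, smul_apply, smul_eq_mul, h.hypersphere x hx]
  field_simp

theorem normal_tangent (h : IsLocalCanal U J f σ z R) (hx : x ∈ U)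
    (u : EuclideanSpace ℝ (Fin n)) :
    minkowski n (unitNormal f σ z R x) (fderiv ℝ f x u) = 0 := by
  have h1 := h.center_perp x hx u
  rw [← neg_sub, map_neg, neg_apply, neg_eq_zero] at h1
  simp only [unitNormal, map_neg, map_smul, neg_apply, smul_apply, h1, smul_zero, neg_zero]

theorem eq_center_sub (h : IsLocalCanal U J f σ z R) (hx : x ∈ U) :
    f x = z (σ x) - R (σ x) • unitNormal f σ z R x := by
  simp [unitNormal, smul_smul, h.radius_ne_zero hx]

/-- Differentiate $f=z(\sigma)-R(\sigma)N$ and solve for $dN$. All later formulas for the shape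
operator rest on this one. -/
theorem fderiv_normal (h : IsLocalCanal U J f σ z R) (hx : x ∈ U)
    (u : EuclideanSpace ℝ (Fin n)) :
    fderiv ℝ (unitNormal f σ z R) x u =
      (R (σ x))⁻¹ • (fderiv ℝ σ x u • canalDirection f σ z R x - fderiv ℝ f x u) := by
  have hR := h.radius_ne_zero hx
  have hσ := differentiableAt_of_contDiffOn h.isOpen h.contDiffOn_param hx
  have hz := differentiableAt_of_contDiffOn h.isOpen_param h.contDiffOn_center (h.mapsTo hx)
  have hR' := differentiableAt_of_contDiffOn h.isOpen_param h.contDiffOn_radius (h.mapsTo hx)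
  have hN := differentiableAt_of_contDiffOn h.isOpen h.contDiffOn_normal hx
  have hzσ := differentiableAt_of_contDiffOn h.isOpen (h.contDiffOn_comp h.contDiffOn_center) hx
  have hRσ := differentiableAt_of_contDiffOn h.isOpen (h.contDiffOn_comp h.contDiffOn_radius) hx
  have h0 : f =ᶠ[𝓝 x] fun y => z (σ y) - R (σ y) • unitNormal f σ z R y := by
    filter_upwards [h.isOpen.mem_nhds hx] with y hy using h.eq_center_sub hy
  have h1 : fderiv ℝ f x u = fderiv ℝ σ x u • deriv z (σ x) -
      (R (σ x) • fderiv ℝ (unitNormal f σ z R) x u +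
        (fderiv ℝ σ x u * deriv R (σ x)) • unitNormal f σ z R x) := by
    rw [h0.fderiv_eq, fderiv_fun_sub hzσ (hRσ.fun_smul hN), fderiv_fun_smul hRσ hN, sub_apply,
      fderiv_comp_real hz hσ, add_apply, ContinuousLinearMap.smulRight_apply,
      fderiv_comp_real hR' hσ]
    simp
  rw [h1, canalDirection, eq_inv_smul_iff₀ hR]
  module

/-- $N^2=-1$ gives $dN(u)\cdot N=0$. Inserting `fderiv_normal` leaves $d\sigma(u)\,T\cdot N=0$, and
the submersion property provides $u$ with $d\sigma(u)\neq0$. -/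
theorem direction_normal (h : IsLocalCanal U J f σ z R) (hx : x ∈ U) :
    minkowski n (canalDirection f σ z R x) (unitNormal f σ z R x) = 0 := by
  obtain ⟨u, hu⟩ := h.submersion x hx
  have hN := differentiableAt_of_contDiffOn h.isOpen h.contDiffOn_normal hx
  have h0 : (fun y => minkowski n (unitNormal f σ z R y) (unitNormal f σ z R y)) =ᶠ[𝓝 x]
      fun _ => (-1 : ℝ) := by
    filter_upwards [h.isOpen.mem_nhds hx] with y hy using h.normal_normal hy
  have h1 := congrArg (fun T : EuclideanSpace ℝ (Fin n) →L[ℝ] ℝ => T u) h0.fderiv_eq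
  rw [fderiv_bilin hN hN, minkowski_symm n (unitNormal f σ z R x)] at h1
  have h2 : minkowski n (fderiv ℝ (unitNormal f σ z R) x u) (unitNormal f σ z R x) = 0 := by
    simp at h1
    linarith
  rw [h.fderiv_normal hx] at h2
  simpa [minkowski_symm n (fderiv ℝ f x u), h.normal_tangent hx, h.radius_ne_zero hx, hu] using h2

theorem deriv_center_normal (h : IsLocalCanal U J f σ z R) (hx : x ∈ U) :
    minkowski n (deriv z (σ x)) (unitNormal f σ z R x) = -deriv R (σ x) := by
  have h1 := h.direction_normal hx
  simp only [canalDirection, map_sub, map_smul, sub_apply, smul_apply, smul_eq_mul,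
    h.normal_normal hx] at h1
  linarith

theorem tangent_decomposition (h : IsLocalCanal U J f σ z R) (hx : x ∈ U) (c : MinkowskiSpace n) :
    ∃ u, c = fderiv ℝ f x u - minkowski n c (unitNormal f σ z R x) • unitNormal f σ z R x :=
  exists_tangent_decomposition (by simp) (h.pos x hx) (h.normal_normal hx) (minkowski_symm n)
    (h.normal_tangent hx) c

/-- If $R'=0$, then $z'\cdot N=0$ and $z'$ is tangent; a positive definite tangent space contains no
light-like vector. -/
theorem deriv_radius_ne_zero (h : IsLocalCanal U J f σ z R) (hx : x ∈ U) :
    deriv R (σ x) ≠ 0 := by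
  intro h0
  obtain ⟨hne, hnull⟩ := h.center_lightLike _ (h.mapsTo hx)
  obtain ⟨u, hu⟩ := h.tangent_decomposition hx (deriv z (σ x))
  rw [h.deriv_center_normal hx, h0, neg_zero, zero_smul, sub_zero] at hu
  by_cases hu0 : u = 0
  · exact hne (by rw [hu, hu0, map_zero])
  · exact (h.pos x hx u hu0).ne' (by rw [← hu, hnull])

/-- With $z'^2=0$, $z'N=-R'$ and $N^2=-1$ the square expands to $0+2R'^2-R'^2$. -/
theorem direction_direction (h : IsLocalCanal U J f σ z R) (hx : x ∈ U) :
    minkowski n (canalDirection f σ z R x) (canalDirection f σ z R x) = deriv R (σ x) ^ 2 := by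
  have h1 := (h.center_lightLike _ (h.mapsTo hx)).2
  have h2 := h.deriv_center_normal hx
  simp only [canalDirection, map_sub, map_smul, sub_apply, smul_apply, smul_eq_mul,
    h.normal_normal hx, minkowski_symm n (unitNormal f σ z R x) (deriv z (σ x)), h1, h2]
  ring

theorem direction_pos (h : IsLocalCanal U J f σ z R) (hx : x ∈ U) :
    0 < minkowski n (canalDirection f σ z R x) (canalDirection f σ z R x) := by
  rw [h.direction_direction hx]
  have := h.deriv_radius_ne_zero hx
  positivity

theorem sqrt_direction (h : IsLocalCanal U J f σ z R) (hx : x ∈ U) :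
    Real.sqrt (minkowski n (canalDirection f σ z R x) (canalDirection f σ z R x)) =
      |deriv R (σ x)| := by
  rw [h.direction_direction hx, Real.sqrt_sq_eq_abs]

theorem exists_field (h : IsLocalCanal U J f σ z R) (hx : x ∈ U) :
    ∃ u, fderiv ℝ f x u =
      (Real.sqrt (minkowski n (canalDirection f σ z R x) (canalDirection f σ z R x)))⁻¹ •
        canalDirection f σ z R x := by
  obtain ⟨u, hu⟩ := h.tangent_decomposition hx
    ((Real.sqrt (minkowski n (canalDirection f σ z R x) (canalDirection f σ z R x)))⁻¹ •
        canalDirection f σ z R x)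
  exact ⟨u, by simpa [h.direction_normal hx] using hu.symm⟩

theorem contDiffOn_unitDirection (h : IsLocalCanal U J f σ z R) :
    ContDiffOn ℝ ∞ (fun y =>
      (Real.sqrt (minkowski n (canalDirection f σ z R y) (canalDirection f σ z R y)))⁻¹ •
        canalDirection f σ z R y) U := by
  have h1 : ContDiffOn ℝ ∞ (fun y => |deriv R (σ y)|) U := fun y hy =>
    (((h.contDiffOn_comp h.contDiffOn_deriv_radius).contDiffAt (h.isOpen.mem_nhds hy)).abs
      (h.deriv_radius_ne_zero hy)).contDiffWithinAt
  refine ((h1.inv fun y hy => abs_ne_zero.mpr (h.deriv_radius_ne_zero hy)).smul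
    h.contDiffOn_direction).congr fun y hy => ?_
  rw [h.sqrt_direction hy]
  rfl

section Field

variable {ξ : EuclideanSpace ℝ (Fin n)}

theorem field_unit (h : IsLocalCanal U J f σ z R) (hx : x ∈ U) (hξ : fderiv ℝ f x ξ =
      (Real.sqrt (minkowski n (canalDirection f σ z R x) (canalDirection f σ z R x)))⁻¹ •
        canalDirection f σ z R x) :
    minkowski n (fderiv ℝ f x ξ) (fderiv ℝ f x ξ) = 1 := by
  have h0 := abs_ne_zero.mpr (h.deriv_radius_ne_zero hx)
  rw [hξ, h.sqrt_direction hx]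
  simp only [map_smul, smul_apply, smul_eq_mul, h.direction_direction hx, ← sq_abs (deriv R (σ x))]
  field_simp

theorem direction_tangent (h : IsLocalCanal U J f σ z R) (hx : x ∈ U) (hξ : fderiv ℝ f x ξ =
      (Real.sqrt (minkowski n (canalDirection f σ z R x) (canalDirection f σ z R x)))⁻¹ •
        canalDirection f σ z R x) (u : EuclideanSpace ℝ (Fin n)) :
    minkowski n (canalDirection f σ z R x) (fderiv ℝ f x u) =
      |deriv R (σ x)| * minkowski n (fderiv ℝ f x ξ) (fderiv ℝ f x u) := by
  have h0 := abs_ne_zero.mpr (h.deriv_radius_ne_zero hx)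
  rw [hξ, h.sqrt_direction hx]
  simp [h0]

/-- The differential of the parameter is a multiple of the form `η = g(ξ, ·)`, because the second
fundamental form is symmetric. -/
theorem fderiv_param (h : IsLocalCanal U J f σ z R) (hx : x ∈ U) (hξ : fderiv ℝ f x ξ =
      (Real.sqrt (minkowski n (canalDirection f σ z R x) (canalDirection f σ z R x)))⁻¹ •
        canalDirection f σ z R x) (u : EuclideanSpace ℝ (Fin n)) :
    fderiv ℝ σ x u = fderiv ℝ σ x ξ * minkowski n (fderiv ℝ f x ξ) (fderiv ℝ f x u) := by
  have hN := differentiableAt_of_contDiffOn h.isOpen h.contDiffOn_normal hx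
  have hf := differentiableAt_of_contDiffOn h.isOpen
    (contDiffOn_fderiv_top h.isOpen h.contDiffOn) hx
  have hh : ∀ u v, minkowski n (fderiv ℝ (unitNormal f σ z R) x u) (fderiv ℝ f x v) =
      -minkowski n (unitNormal f σ z R x) (fderiv ℝ (fderiv ℝ f) x u v) := by
    intro u v
    have h0 : (fun y => minkowski n (unitNormal f σ z R y) (fderiv ℝ f y v)) =ᶠ[𝓝 x]
        fun _ => (0 : ℝ) := by
      filter_upwards [h.isOpen.mem_nhds hx] with y hy using h.normal_tangent hy v
    have h1 := congrArg (fun T : EuclideanSpace ℝ (Fin n) →L[ℝ] ℝ => T u) h0.fderiv_eq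
    rw [fderiv_bilin hN (hf.clm_apply (differentiableAt_const v)),
      fderiv_fderiv_apply h.isOpen h.contDiffOn hx] at h1
    simp at h1
    linarith
  -- Inserting `fderiv_normal` on both sides, the metric terms cancel. What remains is
  -- $d\sigma(u)\,T\cdot df(\xi)=d\sigma(\xi)\,T\cdot df(u)$.
  have hsym : minkowski n (fderiv ℝ (unitNormal f σ z R) x u) (fderiv ℝ f x ξ) =
      minkowski n (fderiv ℝ (unitNormal f σ z R) x ξ) (fderiv ℝ f x u) := by
    rw [hh, hh, fderiv_fderiv_symm h.isOpen h.contDiffOn hx]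
  have hR := h.radius_ne_zero hx
  have h0 := abs_ne_zero.mpr (h.deriv_radius_ne_zero hx)
  rw [h.fderiv_normal hx, h.fderiv_normal hx] at hsym
  simp only [map_smul, smul_apply, map_sub, sub_apply, smul_eq_mul, h.direction_tangent hx hξ,
    h.field_unit hx hξ, minkowski_symm n (fderiv ℝ f x u) (fderiv ℝ f x ξ)] at hsym
  have h2 := mul_left_cancel₀ (inv_ne_zero hR) hsym
  apply mul_left_cancel₀ h0
  linarith

theorem fderiv_param_field_ne_zero (h : IsLocalCanal U J f σ z R) (hx : x ∈ U)
    (hξ : fderiv ℝ f x ξ =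
      (Real.sqrt (minkowski n (canalDirection f σ z R x) (canalDirection f σ z R x)))⁻¹ •
        canalDirection f σ z R x) : fderiv ℝ σ x ξ ≠ 0 := by
  obtain ⟨u, hu⟩ := h.submersion x hx
  rw [h.fderiv_param hx hξ] at hu
  exact left_ne_zero_of_mul hu

/-- The hypersurface is quasi-umbilical: the form is a multiple of $g$ plus a multiple of
$\eta\otimes\eta$, which is what produces the tensors $\pi$ and $\Phi$. -/
theorem secondFundamentalForm_eq (h : IsLocalCanal U J f σ z R) (hx : x ∈ U)
    (hξ : fderiv ℝ f x ξ =
      (Real.sqrt (minkowski n (canalDirection f σ z R x) (canalDirection f σ z R x)))⁻¹ •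
        canalDirection f σ z R x) (u v : EuclideanSpace ℝ (Fin n)) :
    minkowski n (fderiv ℝ (unitNormal f σ z R) x u) (fderiv ℝ f x v) =
      (R (σ x))⁻¹ * (|deriv R (σ x)| * fderiv ℝ σ x ξ *
        minkowski n (fderiv ℝ f x ξ) (fderiv ℝ f x u) *
        minkowski n (fderiv ℝ f x ξ) (fderiv ℝ f x v) -
        minkowski n (fderiv ℝ f x u) (fderiv ℝ f x v)) := by
  rw [h.fderiv_normal hx]
  simp only [map_smul, smul_apply, map_sub, sub_apply, smul_eq_mul, h.direction_tangent hx hξ]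
  rw [h.fderiv_param hx hξ u]
  ring

variable
  {G : EuclideanSpace ℝ (Fin n) → EuclideanSpace ℝ (Fin n) → EuclideanSpace ℝ (Fin n) → ℝ}

/-- In the Gauss equation the $g\cdot g$ terms give $\pi$ and the mixed terms give $\Phi$; the
products of four $\eta$'s cancel by antisymmetry. -/
theorem curvature_eq (h : IsLocalCanal U J f σ z R) (hx : x ∈ U)
    (hG : ∀ y ∈ U, ∀ u v, G y u v = minkowski n (fderiv ℝ f y u) (fderiv ℝ f y v))
    (hξ : fderiv ℝ f x ξ =
      (Real.sqrt (minkowski n (canalDirection f σ z R x) (canalDirection f σ z R x)))⁻¹ •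
        canalDirection f σ z R x) (u v w q : EuclideanSpace ℝ (Fin n)) :
    minkowski n (fderiv ℝ f x (curvatureOperator G x u v w)) (fderiv ℝ f x q) =
      -1 / R (σ x) ^ 2 * (G x v w * G x u q - G x u w * G x v q) +
      |deriv R (σ x)| * fderiv ℝ σ x ξ / R (σ x) ^ 2 *
        (G x v w * G x ξ u * G x ξ q - G x u w * G x ξ v * G x ξ q
          + G x u q * G x ξ v * G x ξ w - G x v q * G x ξ u * G x ξ w) := by
  rw [gauss_equation (by simp) (minkowski_symm n) h.isOpen h.contDiffOn h.pos hG
    h.contDiffOn_normal (fun y hy => h.normal_normal hy) (fun y hy => h.normal_tangent hy) hx]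
  simp only [h.secondFundamentalForm_eq hx hξ, hG x hx]
  ring

theorem covariantDerivative_eq (h : IsLocalCanal U J f σ z R) (hx : x ∈ U)
    (hG : ∀ y ∈ U, ∀ u v, G y u v = minkowski n (fderiv ℝ f y u) (fderiv ℝ f y v))
    {v : EuclideanSpace ℝ (Fin n) → EuclideanSpace ℝ (Fin n)} (hv : ∀ y ∈ U, fderiv ℝ f y (v y) =
      (Real.sqrt (minkowski n (canalDirection f σ z R y) (canalDirection f σ z R y)))⁻¹ •
        canalDirection f σ z R y) {u : EuclideanSpace ℝ (Fin n)}
    (hu : minkowski n (fderiv ℝ f x (v x)) (fderiv ℝ f x u) = 0)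
    (hvd : DifferentiableAt ℝ v x) :
    fderiv ℝ v x u + christoffel G x u (v x) = (deriv R (σ x) / (|deriv R (σ x)| * R (σ x))) • u := by
  refine eq_of_bilin_eq (h.pos x hx) fun q => ?_
  rw [bilin_covariantDerivative (minkowski_symm n) h.isOpen h.contDiffOn h.pos hG hx hvd hv]
  have hR0 := h.deriv_radius_ne_zero hx
  -- Directions orthogonal to $\xi$ do not change the parameter, so $z'$, $R$ and $R'$ are
  -- stationary along $u$.
  have hσu : fderiv ℝ σ x u = 0 := by rw [h.fderiv_param hx (hv x hx), hu, mul_zero]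
  have hσ := differentiableAt_of_contDiffOn h.isOpen h.contDiffOn_param hx
  have hN := differentiableAt_of_contDiffOn h.isOpen h.contDiffOn_normal hx
  have hT := differentiableAt_of_contDiffOn h.isOpen_param h.contDiffOn_deriv_center (h.mapsTo hx)
  have hR' := differentiableAt_of_contDiffOn h.isOpen_param h.contDiffOn_deriv_radius (h.mapsTo hx)
  have habs : DifferentiableAt ℝ (fun r => |deriv R r|⁻¹) (σ x) :=
    (hR'.abs hR0).fun_inv (abs_ne_zero.mpr hR0)
  have hA := habs.fun_smul hT
  have hC := habs.fun_mul hR'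
  have hAσ : DifferentiableAt ℝ (fun y => |deriv R (σ y)|⁻¹ • deriv z (σ y)) x := hA.comp x hσ
  have hCσ : DifferentiableAt ℝ (fun y => |deriv R (σ y)|⁻¹ * deriv R (σ y)) x := hC.comp x hσ
  -- The unit direction is split into functions of $\sigma$ and the normal. Along $u$ only
  -- $dN(u)=-R^{-1}df(u)$ survives, with coefficient $-R'/|R'|$.
  have h0 : (fun y =>
      (Real.sqrt (minkowski n (canalDirection f σ z R y) (canalDirection f σ z R y)))⁻¹ •
        canalDirection f σ z R y) =ᶠ[𝓝 x] fun y => |deriv R (σ y)|⁻¹ • deriv z (σ y) -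
          (|deriv R (σ y)|⁻¹ * deriv R (σ y)) • unitNormal f σ z R y := by
    filter_upwards [h.isOpen.mem_nhds hx] with y hy
    rw [h.sqrt_direction hy, canalDirection, smul_sub, smul_smul]
  rw [h0.fderiv_eq, fderiv_fun_sub hAσ (hCσ.fun_smul hN), fderiv_fun_smul hCσ hN, sub_apply,
    fderiv_comp_real hA hσ, add_apply, ContinuousLinearMap.smulRight_apply,
    fderiv_comp_real hC hσ, hσu, smul_apply, h.fderiv_normal hx, hσu]
  simp only [zero_smul, zero_mul, zero_sub, add_zero, map_neg, map_smul, neg_apply, smul_apply, smul_eq_mul]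
  field_simp

end Field

end IsLocalCanal

/-! ### Passing between the manifold and its charts -/

section Charts

variable {n : ℕ} {M : Type*} [TopologicalSpace M] [ChartedSpace (EuclideanSpace ℝ (Fin n)) M]
  {Y : Type*} [NormedAddCommGroup Y] [NormedSpace ℝ Y]
  {F : M → MinkowskiSpace n} {s : M → ℝ} {z : ℝ → MinkowskiSpace n} {R : ℝ → ℝ}

theorem mfderiv_eq_fderiv_chart (p : M) {h : M → Y} (hh : MDifferentiableAt (𝓡 n) 𝓘(ℝ, Y) h p)
    (u : EuclideanSpace ℝ (Fin n)) :
    mfderiv (𝓡 n) 𝓘(ℝ, Y) h p u =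
      fderiv ℝ (h ∘ (extChartAt (𝓡 n) p).symm) (extChartAt (𝓡 n) p p) u := by
  rw [hh.mfderiv]
  simp only [modelWithCornersSelf_coe, Set.range_id, fderivWithin_univ]
  rfl

theorem canalDirection_chart (p : M) :
    canalDirection (F ∘ (extChartAt (𝓡 n) p).symm) (s ∘ (extChartAt (𝓡 n) p).symm) z R
      (extChartAt (𝓡 n) p p) = canalDirection F s z R p := by
  simp [canalDirection, unitNormal]

theorem differential_eq_fderiv_chart (hF : ContMDiff (𝓡 n) 𝓘(ℝ, MinkowskiSpace n) ∞ F) (p : M)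
    (u : EuclideanSpace ℝ (Fin n)) :
    differential F p u =
      fderiv ℝ (F ∘ (extChartAt (𝓡 n) p).symm) (extChartAt (𝓡 n) p p) u :=
  mfderiv_eq_fderiv_chart p (hF.mdifferentiableAt (by simp)) u

theorem directionalDerivative_eq_fderiv_chart {a : M → ℝ} (ha : ContMDiff (𝓡 n) 𝓘(ℝ, ℝ) ∞ a)
    (p : M) (u : EuclideanSpace ℝ (Fin n)) :
    directionalDerivative a p u =
      fderiv ℝ (a ∘ (extChartAt (𝓡 n) p).symm) (extChartAt (𝓡 n) p p) u :=
  mfderiv_eq_fderiv_chart p (ha.mdifferentiableAt (by simp)) u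

theorem contMDiffAt_of_chart (p : M) {h : M → Y} {c : EuclideanSpace ℝ (Fin n) → Y}
    (hc : ContDiffOn ℝ ∞ c (extChartAt (𝓡 n) p).target)
    (hh : ∀ q ∈ (extChartAt (𝓡 n) p).source, h q = c (extChartAt (𝓡 n) p q)) :
    ContMDiffAt (𝓡 n) 𝓘(ℝ, Y) ∞ h p := by
  have h1 : ContMDiffAt 𝓘(ℝ, EuclideanSpace ℝ (Fin n)) 𝓘(ℝ, Y) ∞ c (extChartAt (𝓡 n) p p) :=
    (hc.contDiffAt ((isOpen_extChartAt_target p).mem_nhds (mem_extChartAt_target p))).contMDiffAt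
  refine (h1.comp p contMDiffAt_extChartAt).congr_of_eventuallyEq ?_
  filter_upwards [extChartAt_source_mem_nhds (I := 𝓡 n) p] with q hq using hh q hq

variable [IsManifold (𝓡 n) ∞ M]

theorem mdifferentiableAt_chart_symm (p : M) {y : EuclideanSpace ℝ (Fin n)}
    (hy : y ∈ (extChartAt (𝓡 n) p).target) :
    MDifferentiableAt 𝓘(ℝ, EuclideanSpace ℝ (Fin n)) (𝓡 n) (extChartAt (𝓡 n) p).symm y := by
  have : IsManifold (𝓡 n) 1 M := IsManifold.of_le (n := ∞) (by simp)
  have h := mdifferentiableWithinAt_extChartAt_symm (I := 𝓡 n) hy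
  simp only [modelWithCornersSelf_coe, Set.range_id, mdifferentiableWithinAt_univ] at h
  exact h

theorem fderiv_comp_chart_symm (p : M) {y : EuclideanSpace ℝ (Fin n)}
    (hy : y ∈ (extChartAt (𝓡 n) p).target) {h : M → Y}
    (hh : MDifferentiableAt (𝓡 n) 𝓘(ℝ, Y) h ((extChartAt (𝓡 n) p).symm y))
    (u : EuclideanSpace ℝ (Fin n)) :
    fderiv ℝ (h ∘ (extChartAt (𝓡 n) p).symm) y u =
      mfderiv (𝓡 n) 𝓘(ℝ, Y) h ((extChartAt (𝓡 n) p).symm y)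
        (mfderiv 𝓘(ℝ, EuclideanSpace ℝ (Fin n)) (𝓡 n) (extChartAt (𝓡 n) p).symm y u) := by
  rw [← mfderiv_eq_fderiv, mfderiv_comp y hh (mdifferentiableAt_chart_symm p hy)]
  rfl

theorem mfderiv_chart_symm_mfderiv_chart (p : M) {y : EuclideanSpace ℝ (Fin n)}
    (hy : y ∈ (extChartAt (𝓡 n) p).target)
    (X : TangentSpace (𝓡 n) ((extChartAt (𝓡 n) p).symm y)) :
    mfderiv 𝓘(ℝ, EuclideanSpace ℝ (Fin n)) (𝓡 n) (extChartAt (𝓡 n) p).symm y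
      (mfderiv (𝓡 n) 𝓘(ℝ, EuclideanSpace ℝ (Fin n)) (extChartAt (𝓡 n) p)
        ((extChartAt (𝓡 n) p).symm y) X) = X := by
  have : IsManifold (𝓡 n) 1 M := IsManifold.of_le (n := ∞) (by simp)
  have h := mfderivWithin_extChartAt_symm_comp_mfderiv_extChartAt (I := 𝓡 n) hy
  simp only [modelWithCornersSelf_coe, Set.range_id, mfderivWithin_univ] at h
  exact congrArg (fun T => T X) h

theorem mfderiv_chart_mfderiv_chart_symm (p : M) {y : EuclideanSpace ℝ (Fin n)}
    (hy : y ∈ (extChartAt (𝓡 n) p).target) (u : EuclideanSpace ℝ (Fin n)) :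
    mfderiv (𝓡 n) 𝓘(ℝ, EuclideanSpace ℝ (Fin n)) (extChartAt (𝓡 n) p)
      ((extChartAt (𝓡 n) p).symm y)
      (mfderiv 𝓘(ℝ, EuclideanSpace ℝ (Fin n)) (𝓡 n) (extChartAt (𝓡 n) p).symm y u) = u := by
  have : IsManifold (𝓡 n) 1 M := IsManifold.of_le (n := ∞) (by simp)
  have h := mfderiv_extChartAt_comp_mfderivWithin_extChartAt_symm (I := 𝓡 n) hy
  simp only [modelWithCornersSelf_coe, Set.range_id, mfderivWithin_univ] at h
  exact congrArg (fun T => T u) h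

theorem fderiv_comp_chart_symm_mfderiv_chart (p : M) {y : EuclideanSpace ℝ (Fin n)}
    (hy : y ∈ (extChartAt (𝓡 n) p).target) {h : M → Y}
    (hh : MDifferentiableAt (𝓡 n) 𝓘(ℝ, Y) h ((extChartAt (𝓡 n) p).symm y))
    (X : TangentSpace (𝓡 n) ((extChartAt (𝓡 n) p).symm y)) :
    fderiv ℝ (h ∘ (extChartAt (𝓡 n) p).symm) y
      (mfderiv (𝓡 n) 𝓘(ℝ, EuclideanSpace ℝ (Fin n)) (extChartAt (𝓡 n) p)
        ((extChartAt (𝓡 n) p).symm y) X) =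
      mfderiv (𝓡 n) 𝓘(ℝ, Y) h ((extChartAt (𝓡 n) p).symm y) X := by
  exact (fderiv_comp_chart_symm p hy hh _).trans
    (congrArg _ (mfderiv_chart_symm_mfderiv_chart p hy X))

theorem contDiffOn_chart (p : M) {h : M → Y} (hh : ContMDiff (𝓡 n) 𝓘(ℝ, Y) ∞ h) :
    ContDiffOn ℝ ∞ (h ∘ (extChartAt (𝓡 n) p).symm) (extChartAt (𝓡 n) p).target :=
  contMDiffOn_iff_contDiffOn.mp (hh.comp_contMDiffOn (contMDiffOn_extChartAt_symm p))

/-- A map with surjective strict derivative is locally open. Openness of $J$ is what makes `deriv z`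
and `deriv R` smooth on $J$. -/
theorem isOpen_range_of_submersion {s : M → ℝ} (hs : ContMDiff (𝓡 n) 𝓘(ℝ, ℝ) ∞ s)
    (hsub : ∀ p : M, ∃ X : TangentSpace (𝓡 n) p, directionalDerivative s p X ≠ 0) :
    IsOpen (Set.range s) := by
  rw [isOpen_iff_mem_nhds]
  rintro _ ⟨p, rfl⟩
  have ho := (isOpen_extChartAt_target (I := 𝓡 n) p).mem_nhds (mem_extChartAt_target p)
  have hd : HasStrictFDerivAt (s ∘ (extChartAt (𝓡 n) p).symm)
      (fderiv ℝ (s ∘ (extChartAt (𝓡 n) p).symm) (extChartAt (𝓡 n) p p)) (extChartAt (𝓡 n) p p) :=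
    ((contDiffOn_chart p hs).contDiffAt ho).hasStrictFDerivAt (by simp)
  have hmd : MDifferentiableAt (𝓡 n) 𝓘(ℝ, ℝ) s p := hs.mdifferentiableAt (by simp)
  have hsurj : (fderiv ℝ (s ∘ (extChartAt (𝓡 n) p).symm) (extChartAt (𝓡 n) p p)).range = ⊤ := by
    obtain ⟨X, hX⟩ := hsub p
    rw [directionalDerivative] at hX
    have hX' := mfderiv_eq_fderiv_chart p hmd X
    rw [LinearMap.range_eq_top]
    apply LinearMap.surjective
    intro h0
    apply hX
    refine hX'.trans ?_
    exact congrArg (fun T : EuclideanSpace ℝ (Fin n) →ₗ[ℝ] ℝ => T X) h0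
  have h1 := hd.map_nhds_eq_of_surj hsurj
  have h2 : (s ∘ (extChartAt (𝓡 n) p).symm) (extChartAt (𝓡 n) p p) = s p := by simp
  rw [h2] at h1
  rw [← h1, mem_map]
  exact Filter.univ_mem' fun y => ⟨_, rfl⟩

end Charts

/-! ### Transfer of the local results to $M$ -/

section Transfer

variable {n : ℕ} {M : Type*} [TopologicalSpace M] [ChartedSpace (EuclideanSpace ℝ (Fin n)) M]
  [IsManifold (𝓡 n) ∞ M] {F : M → MinkowskiSpace n} {s : M → ℝ} {z : ℝ → MinkowskiSpace n}
  {R : ℝ → ℝ}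

theorem IsCanalSpacelikeHypersurface.isLocalCanal (h : IsCanalSpacelikeHypersurface F s z R)
    (hp : IsOfParabolicType s z) (p : M) :
    IsLocalCanal (extChartAt (𝓡 n) p).target (Set.range s) (F ∘ (extChartAt (𝓡 n) p).symm)
      (s ∘ (extChartAt (𝓡 n) p).symm) z R where
  isOpen := isOpen_extChartAt_target p
  isOpen_param := isOpen_range_of_submersion h.contMDiff_param h.submersion
  contDiffOn := contDiffOn_chart p h.contMDiff
  contDiffOn_param := contDiffOn_chart p h.contMDiff_param
  mapsTo _ _ := ⟨_, rfl⟩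
  contDiffOn_center := h.contDiffOn_center
  contDiffOn_radius := h.contDiffOn_radius
  pos y hy u hu := by
    rw [fderiv_comp_chart_symm p hy (h.contMDiff.mdifferentiableAt (by simp))]
    refine h.spacelike _ _ fun h0 => hu ?_
    exact (mfderiv_chart_mfderiv_chart_symm p hy u).symm.trans
      ((congrArg _ h0).trans (map_zero _))
  center_perp y hy u := by
    rw [fderiv_comp_chart_symm p hy (h.contMDiff.mdifferentiableAt (by simp))]
    exact h.center_mem_normalLine _ _
  radius_pos := h.radius_pos
  hypersphere y _ := h.mem_hypersphere _
  submersion y hy := by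
    obtain ⟨X, hX⟩ := h.submersion ((extChartAt (𝓡 n) p).symm y)
    refine ⟨mfderiv (𝓡 n) 𝓘(ℝ, EuclideanSpace ℝ (Fin n)) (extChartAt (𝓡 n) p)
        ((extChartAt (𝓡 n) p).symm y) X, ?_⟩
    rw [fderiv_comp_chart_symm_mfderiv_chart p hy (h.contMDiff_param.mdifferentiableAt (by simp))]
    exact hX
  center_lightLike := hp

theorem metricInChart_inducedMetric (hF : ContMDiff (𝓡 n) 𝓘(ℝ, MinkowskiSpace n) ∞ F)
    (hs : IsSpacelike F) (p : M) {y : EuclideanSpace ℝ (Fin n)}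
    (hy : y ∈ (extChartAt (𝓡 n) p).target) (u v : EuclideanSpace ℝ (Fin n)) :
    metricInChart (inducedMetric F hF hs) p y u v =
      minkowski n (fderiv ℝ (F ∘ (extChartAt (𝓡 n) p).symm) y u)
        (fderiv ℝ (F ∘ (extChartAt (𝓡 n) p).symm) y v) := by
  rw [fderiv_comp_chart_symm p hy (hF.mdifferentiableAt (by simp)),
    fderiv_comp_chart_symm p hy (hF.mdifferentiableAt (by simp))]
  rfl

theorem inducedMetric_inner (hF : ContMDiff (𝓡 n) 𝓘(ℝ, MinkowskiSpace n) ∞ F)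
    (hs : IsSpacelike F) (p : M) (u v : EuclideanSpace ℝ (Fin n)) :
    (inducedMetric F hF hs).inner p u v =
      minkowski n (fderiv ℝ (F ∘ (extChartAt (𝓡 n) p).symm) (extChartAt (𝓡 n) p p) u)
        (fderiv ℝ (F ∘ (extChartAt (𝓡 n) p).symm) (extChartAt (𝓡 n) p p) v) := by
  rw [← differential_eq_fderiv_chart hF, ← differential_eq_fderiv_chart hF]
  rfl

/-- The coordinate expression of a vector field in the preferred chart around `p`. -/
def fieldInChart (ξ : ∀ p : M, TangentSpace (𝓡 n) p) (p : M) (y : EuclideanSpace ℝ (Fin n)) :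
    EuclideanSpace ℝ (Fin n) :=
  mfderiv (𝓡 n) 𝓘(ℝ, EuclideanSpace ℝ (Fin n)) (extChartAt (𝓡 n) p)
    ((extChartAt (𝓡 n) p).symm y) (ξ ((extChartAt (𝓡 n) p).symm y))

/-- The trivialization of the tangent bundle at $p$ is the differential of the preferred chart, so
the coordinate expression is the section read in that trivialization. -/
theorem contMDiffAt_of_fieldInChart {ξ : ∀ p : M, TangentSpace (𝓡 n) p} {p : M}
    (h : ContDiffOn ℝ ∞ (fieldInChart ξ p) (extChartAt (𝓡 n) p).target) :
    ContMDiffAt (𝓡 n) (𝓡 n).tangent ∞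
      (fun p : M => (⟨p, ξ p⟩ : TangentBundle (𝓡 n) M)) p := by
  have : IsManifold (𝓡 n) 1 M := IsManifold.of_le (n := ∞) (by simp)
  refine (Bundle.contMDiffAt_section p).mpr (contMDiffAt_of_chart p h fun q hq => ?_)
  have hq' : q ∈ (chartAt (EuclideanSpace ℝ (Fin n)) p).source := by
    simpa [extChartAt_source] using hq
  have h1 := TangentBundle.continuousLinearMapAt_trivializationAt (I := 𝓡 n) hq'
  have hb : q ∈ (trivializationAt (EuclideanSpace ℝ (Fin n))
      (TangentSpace (𝓡 n) : M → Type _) p).baseSet := by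
    simpa using hq'
  have h2 := Bundle.Trivialization.continuousLinearMapAt_apply_of_mem (R := ℝ)
    (trivializationAt (EuclideanSpace ℝ (Fin n)) (TangentSpace (𝓡 n) : M → Type _) p) hb (ξ q)
  rw [fieldInChart, (extChartAt (𝓡 n) p).left_inv hq]
  exact h2.symm.trans (congrArg (fun T => T (ξ q)) h1)

/-- The preferred chart at $p$ has identity differential at $p$; this matches `curvatureTensor`,
where $T_pM$ is treated as $\mathbb R^n$. -/
theorem fieldInChart_self (ξ : ∀ p : M, TangentSpace (𝓡 n) p) (p : M) :
    fieldInChart ξ p (extChartAt (𝓡 n) p p) = ξ p := by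
  have : IsManifold (𝓡 n) 1 M := IsManifold.of_le (n := ∞) (by simp)
  rw [fieldInChart, (extChartAt (𝓡 n) p).left_inv (mem_extChartAt_source p)]
  exact congrArg (fun T => T (ξ p)) (mfderiv_extChartAt_self (I := 𝓡 n) (x := p))

/-- A pointwise choice suffices: $dF$ is injective, so the field is determined, and
`contDiffOn_fieldInChart` yields its smoothness. -/
theorem IsCanalSpacelikeHypersurface.exists_isCanalField
    (h : IsCanalSpacelikeHypersurface F s z R) (hp : IsOfParabolicType s z) :
    ∃ ξ : ∀ p : M, TangentSpace (𝓡 n) p, IsCanalField F s z R ξ := by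
  have hex : ∀ p : M, ∃ X : TangentSpace (𝓡 n) p,
      0 < minkowski n (canalDirection F s z R p) (canalDirection F s z R p) ∧
      differential F p X =
        (Real.sqrt (minkowski n (canalDirection F s z R p) (canalDirection F s z R p)))⁻¹ •
          canalDirection F s z R p := by
    intro p
    have hl := h.isLocalCanal hp p
    have hx := mem_extChartAt_target (I := 𝓡 n) p
    obtain ⟨u, hu⟩ := hl.exists_field hx
    have hpos := hl.direction_pos hx
    rw [canalDirection_chart] at hu hpos
    exact ⟨u, hpos, (differential_eq_fderiv_chart h.contMDiff p u).trans hu⟩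
  choose ξ hξ using hex
  exact ⟨ξ, hξ⟩

namespace IsCanalField

variable {ξ : ∀ p : M, TangentSpace (𝓡 n) p}

theorem fderiv_fieldInChart (hξ : IsCanalField F s z R ξ)
    (h : IsCanalSpacelikeHypersurface F s z R) (p : M) {y : EuclideanSpace ℝ (Fin n)}
    (hy : y ∈ (extChartAt (𝓡 n) p).target) :
    fderiv ℝ (F ∘ (extChartAt (𝓡 n) p).symm) y (fieldInChart ξ p y) =
      (Real.sqrt (minkowski n
        (canalDirection (F ∘ (extChartAt (𝓡 n) p).symm) (s ∘ (extChartAt (𝓡 n) p).symm) z R y)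
        (canalDirection (F ∘ (extChartAt (𝓡 n) p).symm) (s ∘ (extChartAt (𝓡 n) p).symm) z R y)))⁻¹ •
        canalDirection (F ∘ (extChartAt (𝓡 n) p).symm) (s ∘ (extChartAt (𝓡 n) p).symm) z R y :=
  (fderiv_comp_chart_symm_mfderiv_chart p hy (h.contMDiff.mdifferentiableAt (by simp)) _).trans
    (hξ _).2

theorem fderiv_field (hξ : IsCanalField F s z R ξ)
    (h : IsCanalSpacelikeHypersurface F s z R) (p : M) :
    fderiv ℝ (F ∘ (extChartAt (𝓡 n) p).symm) (extChartAt (𝓡 n) p p) (ξ p) =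
      (Real.sqrt (minkowski n
        (canalDirection (F ∘ (extChartAt (𝓡 n) p).symm) (s ∘ (extChartAt (𝓡 n) p).symm) z R
          (extChartAt (𝓡 n) p p))
        (canalDirection (F ∘ (extChartAt (𝓡 n) p).symm) (s ∘ (extChartAt (𝓡 n) p).symm) z R
          (extChartAt (𝓡 n) p p))))⁻¹ •
        canalDirection (F ∘ (extChartAt (𝓡 n) p).symm) (s ∘ (extChartAt (𝓡 n) p).symm) z R
          (extChartAt (𝓡 n) p p) := by
  have h1 := hξ.fderiv_fieldInChart h p (mem_extChartAt_target p)
  rwa [fieldInChart_self] at h1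

theorem contDiffOn_fieldInChart (hξ : IsCanalField F s z R ξ)
    (h : IsCanalSpacelikeHypersurface F s z R) (hp : IsOfParabolicType s z) (p : M) :
    ContDiffOn ℝ ∞ (fieldInChart ξ p) (extChartAt (𝓡 n) p).target := by
  have hl := h.isLocalCanal hp p
  refine contDiffOn_of_bilin_eq (minkowski_symm n) hl.isOpen hl.contDiffOn hl.pos
    hl.contDiffOn_unitDirection fun y hy q => ?_
  rw [hξ.fderiv_fieldInChart h p hy]

theorem inner_self (hξ : IsCanalField F s z R ξ) (h : IsCanalSpacelikeHypersurface F s z R)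
    (hp : IsOfParabolicType s z) (p : M) :
    (inducedMetric F h.contMDiff h.spacelike).inner p (ξ p) (ξ p) = 1 :=
  (inducedMetric_inner h.contMDiff h.spacelike p (ξ p) (ξ p)).trans
    ((h.isLocalCanal hp p).field_unit (mem_extChartAt_target p) (hξ.fderiv_field h p))

theorem curvatureTensor_eq (hξ : IsCanalField F s z R ξ)
    (h : IsCanalSpacelikeHypersurface F s z R) (hp : IsOfParabolicType s z) (p : M)
    (X Y Z U : TangentSpace (𝓡 n) p) :
    curvatureTensor (inducedMetric F h.contMDiff h.spacelike) p X Y Z U =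
      -1 / R (s p) ^ 2 * tensorPi (inducedMetric F h.contMDiff h.spacelike) p X Y Z U +
      |deriv R (s p)| * directionalDerivative s p (ξ p) / R (s p) ^ 2 *
        tensorPhi (inducedMetric F h.contMDiff h.spacelike) ξ p X Y Z U := by
  have hx := mem_extChartAt_target (I := 𝓡 n) p
  have hG : ∀ y ∈ (extChartAt (𝓡 n) p).target, ∀ u v, _ = _ := fun y hy =>
    metricInChart_inducedMetric h.contMDiff h.spacelike p hy
  have hg : ∀ u v : TangentSpace (𝓡 n) p,
      metricInChart (inducedMetric F h.contMDiff h.spacelike) p (extChartAt (𝓡 n) p p) u v =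
        (inducedMetric F h.contMDiff h.spacelike).inner p u v := fun u v =>
    (hG _ hx u v).trans (inducedMetric_inner h.contMDiff h.spacelike p u v).symm
  have h1 := (h.isLocalCanal hp p).curvature_eq hx hG (hξ.fderiv_field h p) X Y Z U
  have hs : (s ∘ (extChartAt (𝓡 n) p).symm) (extChartAt (𝓡 n) p p) = s p := by simp
  rw [hs] at h1
  have hd := directionalDerivative_eq_fderiv_chart h.contMDiff_param p (ξ p)
  rw [hd]
  simp only [tensorPi, tensorPhi, ← hg]
  exact (inducedMetric_inner h.contMDiff h.spacelike p _ _).trans h1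

theorem covariantDerivative_eq (hξ : IsCanalField F s z R ξ)
    (h : IsCanalSpacelikeHypersurface F s z R) (hp : IsOfParabolicType s z) (p : M)
    (x : TangentSpace (𝓡 n) p)
    (hx : (inducedMetric F h.contMDiff h.spacelike).inner p (ξ p) x = 0) :
    covariantDerivative (inducedMetric F h.contMDiff h.spacelike) ξ p x =
      (deriv R (s p) / (|deriv R (s p)| * R (s p))) • x := by
  have hl := h.isLocalCanal hp p
  have hp' := mem_extChartAt_target (I := 𝓡 n) p
  have h0 := (inducedMetric_inner h.contMDiff h.spacelike p (ξ p) x).symm.trans hx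
  rw [← fieldInChart_self ξ p] at h0
  have h1 := hl.covariantDerivative_eq hp'
    (fun y hy => metricInChart_inducedMetric h.contMDiff h.spacelike p hy)
    (fun y hy => hξ.fderiv_fieldInChart h p hy) h0
    (differentiableAt_of_contDiffOn hl.isOpen (hξ.contDiffOn_fieldInChart h hp p) hp')
  have hs : (s ∘ (extChartAt (𝓡 n) p).symm) (extChartAt (𝓡 n) p p) = s p := by simp
  rw [hs, fieldInChart_self] at h1
  exact h1

theorem directionalDerivative_param_ne_zero (hξ : IsCanalField F s z R ξ)
    (h : IsCanalSpacelikeHypersurface F s z R) (hp : IsOfParabolicType s z) (p : M) :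
    directionalDerivative s p (ξ p) ≠ 0 := by
  have h1 := (h.isLocalCanal hp p).fderiv_param_field_ne_zero (mem_extChartAt_target p)
    (hξ.fderiv_field h p)
  exact fun h0 => h1 ((directionalDerivative_eq_fderiv_chart h.contMDiff_param p (ξ p)).symm.trans h0)

theorem directionalDerivative_param_chart
    (h : IsCanalSpacelikeHypersurface F s z R) (p : M) {y : EuclideanSpace ℝ (Fin n)}
    (hy : y ∈ (extChartAt (𝓡 n) p).target) :
    directionalDerivative s ((extChartAt (𝓡 n) p).symm y) (ξ ((extChartAt (𝓡 n) p).symm y)) =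
      fderiv ℝ (s ∘ (extChartAt (𝓡 n) p).symm) y (fieldInChart ξ p y) :=
  (fderiv_comp_chart_symm_mfderiv_chart p hy
    (h.contMDiff_param.mdifferentiableAt (by simp)) _).symm

end IsCanalField

/-- Functions of the parameter which are smooth on its range are smooth on the hypersurface. -/
theorem IsCanalSpacelikeHypersurface.contMDiff_comp_param
    (h : IsCanalSpacelikeHypersurface F s z R) {c : ℝ → ℝ} (hc : ContDiffOn ℝ ∞ c (Set.range s)) :
    ContMDiff (𝓡 n) 𝓘(ℝ, ℝ) ∞ (fun p => c (s p)) := fun p =>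
  ((hc.contDiffAt ((isOpen_range_of_submersion h.contMDiff_param h.submersion).mem_nhds
    ⟨p, rfl⟩)).contMDiffAt).comp p (h.contMDiff_param p)

theorem IsCanalSpacelikeHypersurface.deriv_radius_ne_zero
    (h : IsCanalSpacelikeHypersurface F s z R) (hp : IsOfParabolicType s z) :
    ∀ r ∈ Set.range s, deriv R r ≠ 0 := by
  rintro _ ⟨p, rfl⟩
  simpa using (h.isLocalCanal hp p).deriv_radius_ne_zero (mem_extChartAt_target p)

namespace IsCanalField

variable {ξ : ∀ p : M, TangentSpace (𝓡 n) p}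

theorem areCurvatureFunctions (hξ : IsCanalField F s z R ξ)
    (h : IsCanalSpacelikeHypersurface F s z R) (hp : IsOfParabolicType s z) :
    AreCurvatureFunctions (inducedMetric F h.contMDiff h.spacelike) ξ
      (fun p => -1 / R (s p) ^ 2)
      (fun p => |deriv R (s p)| * directionalDerivative s p (ξ p) / R (s p) ^ 2)
      (fun p => deriv R (s p) / (|deriv R (s p)| * R (s p))) := by
  have hJ := isOpen_range_of_submersion h.contMDiff_param h.submersion
  have hR0 : ∀ r ∈ Set.range s, R r ≠ 0 := fun r hr => (h.radius_pos r hr).ne'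
  have hR1 := h.deriv_radius_ne_zero hp
  have hdR : ContDiffOn ℝ ∞ (deriv R) (Set.range s) :=
    h.contDiffOn_radius.deriv_of_isOpen hJ (by simp)
  have habs : ContDiffOn ℝ ∞ (fun r => |deriv R r|) (Set.range s) := fun r hr =>
    ((hdR.contDiffAt (hJ.mem_nhds hr)).abs (hR1 r hr)).contDiffWithinAt
  have ha : ContDiffOn ℝ ∞ (fun r => -1 / R r ^ 2) (Set.range s) :=
    contDiffOn_const.div (h.contDiffOn_radius.pow 2) fun r hr => pow_ne_zero 2 (hR0 r hr)
  have hk : ContDiffOn ℝ ∞ (fun r => deriv R r / (|deriv R r| * R r)) (Set.range s) :=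
    hdR.div (habs.mul h.contDiffOn_radius) fun r hr =>
      mul_ne_zero (abs_ne_zero.mpr (hR1 r hr)) (hR0 r hr)
  have hdiff : ContMDiff (𝓡 n) 𝓘(ℝ, ℝ) ∞ (fun p => directionalDerivative s p (ξ p)) := by
    intro p
    have hl := h.isLocalCanal hp p
    refine contMDiffAt_of_chart p ((contDiffOn_fderiv_top hl.isOpen hl.contDiffOn_param).clm_apply
      (hξ.contDiffOn_fieldInChart h hp p)) fun q hq => ?_
    rw [← directionalDerivative_param_chart h p ((extChartAt (𝓡 n) p).map_source hq),
      (extChartAt (𝓡 n) p).left_inv hq]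
  have haM := h.contMDiff_comp_param ha
  have hbc : ContDiffOn ℝ ∞ (fun r => |deriv R r| / R r ^ 2) (Set.range s) :=
    habs.div (h.contDiffOn_radius.pow 2) fun r hr => pow_ne_zero 2 (hR0 r hr)
  refine ⟨haM, ?_, h.contMDiff_comp_param hk, fun p => ?_, fun p => hξ.curvatureTensor_eq h hp p,
    fun p => hξ.covariantDerivative_eq h hp p, fun p => ?_⟩
  · refine ((h.contMDiff_comp_param hbc).mul hdiff).congr fun p => ?_
    simp only [Pi.mul_apply]
    ring
  · have hsp : s p ∈ Set.range s := ⟨p, rfl⟩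
    exact div_ne_zero (mul_ne_zero (abs_ne_zero.mpr (hR1 _ hsp))
      (hξ.directionalDerivative_param_ne_zero h hp p)) (pow_ne_zero 2 (hR0 _ hsp))
  · have hsp : s p ∈ Set.range s := ⟨p, rfl⟩
    have hl := h.isLocalCanal hp p
    have hx := mem_extChartAt_target (I := 𝓡 n) p
    have hs : (s ∘ (extChartAt (𝓡 n) p).symm) (extChartAt (𝓡 n) p p) = s p := by simp
    have hRd := differentiableAt_of_contDiffOn hJ h.contDiffOn_radius hsp
    have hader : HasDerivAt (fun r => -1 / R r ^ 2) (2 * deriv R (s p) / R (s p) ^ 3) (s p) := by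
      have h1 := (hasDerivAt_const (s p) (-1 : ℝ)).fun_div (hRd.hasDerivAt.fun_pow 2)
        (pow_ne_zero 2 (hR0 _ hsp))
      refine h1.congr_deriv ?_
      have := hR0 _ hsp
      field_simp
      ring
    -- Chain rule for $a=-1/R(s)^2$. Dividing by $2b=2|R'|\,\xi(s)/R^2$ cancels $\xi(s)$ and leaves
    -- $R'/(|R'|R)=k$.
    have hda : directionalDerivative (fun p => -1 / R (s p) ^ 2) p (ξ p) =
        directionalDerivative s p (ξ p) * (2 * deriv R (s p) / R (s p) ^ 3) := by
      have e1 := directionalDerivative_eq_fderiv_chart haM p (ξ p)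
      have e2 := directionalDerivative_eq_fderiv_chart h.contMDiff_param p (ξ p)
      have e3 := fderiv_comp_real (c := fun r => -1 / R r ^ 2)
        (σ := s ∘ (extChartAt (𝓡 n) p).symm) (x := extChartAt (𝓡 n) p p)
        (by rw [hs]; exact hader.differentiableAt)
        (differentiableAt_of_contDiffOn hl.isOpen hl.contDiffOn_param hx) (ξ p)
      rw [hs, hader.deriv, smul_eq_mul] at e3
      rw [e2]
      exact e1.trans e3
    have h1 := hR0 _ hsp
    have h2 := abs_ne_zero.mpr (hR1 _ hsp)
    have h3 := hξ.directionalDerivative_param_ne_zero h hp p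
    simp only [hda]
    field_simp

end IsCanalField

/-! ### Sectional curvature as a function of the angle -/

section SectionalCurvature

variable {g : Metric n M} {ξ : ∀ p : M, TangentSpace (𝓡 n) p}

/-- Bessel's inequality for a unit vector and an orthonormal pair. -/
theorem IsOrthonormalPair.bessel {p : M} {X Y Z : TangentSpace (𝓡 n) p}
    (h : IsOrthonormalPair g p X Y) (hZ : g.inner p Z Z = 1) :
    g.inner p Z X ^ 2 + g.inner p Z Y ^ 2 ≤ 1 := by
  obtain ⟨hX, hY, hXY⟩ := h
  set W := Z - g.inner p Z X • X - g.inner p Z Y • Y with hW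
  have h0 : 0 ≤ g.inner p W W := by
    by_cases hW0 : W = 0
    · simp [hW0]
    · exact (g.pos p W hW0).le
  have h1 : g.inner p W W = 1 - g.inner p Z X ^ 2 - g.inner p Z Y ^ 2 := by
    rw [hW]
    simp only [map_sub, map_smul, sub_apply, smul_apply, smul_eq_mul, hX, hY, hXY, hZ,
      g.symm p Y X, g.symm p X Z, g.symm p Y Z]
    ring
  linarith

theorem AreCurvatureFunctions.sectional {a b k : M → ℝ} (h : AreCurvatureFunctions g ξ a b k)
    (hunit : ∀ p, g.inner p (ξ p) (ξ p) = 1) (p : M) (X Y : TangentSpace (𝓡 n) p)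
    (hXY : IsOrthonormalPair g p X Y) :
    sectionalCurvature g p X Y =
      a p + b p * Real.cos (planeAngle g p (ξ p) X Y) ^ 2 := by
  -- `Real.arccos` is constant beyond $1$; Bessel's bound is needed for the cosine to return the
  -- projection length. On an orthonormal pair $\pi=1$ and $\Phi=\eta(X)^2+\eta(Y)^2$.
  have hle := hXY.bessel (hunit p)
  have hnn : 0 ≤ g.inner p (ξ p) X ^ 2 + g.inner p (ξ p) Y ^ 2 := by positivity
  rw [planeAngle, Real.cos_arccos (by linarith [Real.sqrt_nonneg (g.inner p (ξ p) X ^ 2 +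
    g.inner p (ξ p) Y ^ 2)]) (Real.sqrt_le_one.mpr hle), Real.sq_sqrt hnn, sectionalCurvature,
    h.curvature, tensorPi, tensorPhi]
  obtain ⟨hX, hY, hXY'⟩ := hXY
  rw [g.symm p Y X, hX, hY, hXY']
  ring

end SectionalCurvature

end Transfer

end CanalQC

end

theorem proposition3p12 (n : ℕ) (hn : 4 ≤ n) {M : Type*} [TopologicalSpace M]
    [ChartedSpace (EuclideanSpace ℝ (Fin n)) M] [IsManifold (𝓡 n) ∞ M]
    (F : M → CanalQC.MinkowskiSpace n) (s : M → ℝ) (z : ℝ → CanalQC.MinkowskiSpace n) (R : ℝ → ℝ)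
    (hcanal : CanalQC.IsCanalSpacelikeHypersurface F s z R)
    (hparabolic : CanalQC.IsOfParabolicType s z) :
    ∃ ξ : ∀ p : M, TangentSpace (𝓡 n) p,
      CanalQC.IsCanalField F s z R ξ ∧
      CanalQC.IsQCManifold
        (CanalQC.inducedMetric F hcanal.contMDiff hcanal.spacelike) ξ ∧
      ∃ a b k : M → ℝ,
        CanalQC.AreCurvatureFunctions
          (CanalQC.inducedMetric F hcanal.contMDiff hcanal.spacelike) ξ a b k ∧
        (∀ p : M, a p = -1 / R (s p) ^ 2) ∧
        (∀ p : M, a p + k p ^ 2 = 0) := by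
  obtain ⟨ξ, hξ⟩ := hcanal.exists_isCanalField hparabolic
  have hcurv := hξ.areCurvatureFunctions hcanal hparabolic
  have hunit := hξ.inner_self hcanal hparabolic
  refine ⟨ξ, hξ, ⟨fun p => CanalQC.contMDiffAt_of_fieldInChart
    (hξ.contDiffOn_fieldInChart hcanal hparabolic p), hunit, ?_⟩, _, _, _, hcurv, fun _ => rfl,
    fun p => ?_⟩
  -- The holes are $a(p)$ and $b(p)$, found by unification.
  · exact ⟨fun p θ => _ + _ * Real.cos θ ^ 2, fun p X Y hXY => hcurv.sectional hunit p X Y hXY⟩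
  · have h1 := hcanal.radius_pos _ ⟨p, rfl⟩
    have h2 := hcanal.deriv_radius_ne_zero hparabolic _ ⟨p, rfl⟩
    rw [div_pow, mul_pow, sq_abs]
    field_simp
    ring
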